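/- All vector spaces are over $\mathbb{C}$. Let $n\ge 2$ and let $\mathfrak q=\mathfrak q(n)$ be the queer Lie superalgebra of block matrices $\left(\begin{smallmatrix}X&Y\\Y&X\end{smallmatrix}\right)$, $X,Y\in\mathrm{Mat}_n(\mathbb C)$ ($X$ is the even part, $Y$ the odd part), with the supercommutator. Let $\mathfrak h=\mathfrak h_{\bar0}\oplus\mathfrak h_{\bar1}$ (diagonal $X,Y$) be its Cartan subalgebra, $\mathfrak n^+$ (strictly upper triangular $X,Y$) its positive part, and, for $1\le i\le n$ resp. $1\le i\le n-1$, let $k_i,f_i\in\mathfrak q_{\bar 0}$ be the elements with $X=E_{i,i}$ resp. $X=E_{i+1,i}$, and $h_i=k_i-k_{i+1}$. Let $\epsilon_i\in\mathfrak h_{\bar0}^*$ be the basis dual to $(k_i)$ and $Q^+=\sum_{i=1}^{n-1}\mathbb Z_{\ge0}(\epsilon_i-\epsilon_{i+1})$. Let $\Lambda^+$ be the set of $\lambda=\sum_i\lambda_i\epsilon_i$ such that, for all $i\le n-1$, $\lambda_i-\lambda_{i+1}\in\mathbb Z_{\ge0}$, and $\lambda_i=\lambda_{i+1}$ implies $\lambda_i=\lambda_{i+1}=0$.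 Let $A$ be a commutative associative unital algebra; $\mathfrak q\otimes A$ has the bracket $[x\otimes a,y\otimes b]=[x,y]\otimes ab$ and contains the image $\mathfrak q\otimes 1$ of $\mathfrak q$, through which weight spaces $M_\mu=\{m: hm=\mu(h)m\ \forall h\in\mathfrak h_{\bar0}\}$ of $\mathfrak q\otimes A$-modules are formed. Modules are $\mathbb Z/2$-graded and homomorphisms are even. Let $\lambda\in\Lambda^+$ and let $L(\lambda)$ be any irreducible highest weight $\mathfrak q$-module of highest weight $\lambda$ (it is unique up to the parity change $\Pi$, and so are the modules built from it; the statement holds for each choice). Let $\bar L(\lambda)$ be the $\mathfrak q$-module generated by the $\mathfrak h$-module $L(\lambda)_\lambda$ with defining relations $\mathfrak n^+k=0$, $hk=\lambda(h)k$, $f_i^{\lambda(h_i)+1}k=0$ for all $k\in L(\lambda)_\lambda$, $h\in\mathfrak h_{\bar0}$, $1\le i\le n-1$. Let $P=\mathbf U(\mathfrak q\otimes A)\otimes_{\mathbf U(\mathfrak q)}\bar L(\lambda)$, and let $$W_A(\lambda)=P\Big/\sum_{\mu\notin\lambda-Q^+}\mathbf U(\mathfrak q\otimes A)P_\mu$$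 be the global Weyl module. For $k\in L(\lambda)_\lambda$ let $w_k\in W_A(\lambda)$ be the image of $1\otimes k$. **Proposition.** The $\mathfrak q\otimes A$-module $W_A(\lambda)$ is generated by its weight space $W_A(\lambda)_\lambda$, with defining relations $$(\mathfrak n^+\otimes A)w=0,\qquad hw=\lambda(h)w\quad(h\in\mathfrak h_{\bar0}),\qquad f_i^{\lambda(h_i)+1}w=0\quad(1\le i\le n-1).\tag{$*$}$$ That is: 1. $W_A(\lambda)$ is generated by $W_A(\lambda)_\lambda$, and $(*)$ holds for every $w\in W_A(\lambda)_\lambda$. 2. The map $k\mapsto w_k$ is an even homomorphism of $\mathfrak h$-modules $L(\lambda)_\lambda\to W_A(\lambda)_\lambda$, the $w_k$ generate $W_A(\lambda)$, and $(*)$ for $w=w_k$ are the defining relations: for every $\mathfrak q\otimes A$-module $M$ and every even homomorphism of $\mathfrak h$-modules $\varphi:L(\lambda)_\lambda\to M$ such that all $\varphi(k)$ satisfy $(*)$, there is a unique homomorphism of $\mathfrak q\otimes A$-modules $\Phi:W_A(\lambda)\to M$ with $\Phi(w_k)=\varphi(k)$ for all $k$. 3. The same holds with the whole weight space as generating space: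 for every $\mathfrak q\otimes A$-module $M$ and every even homomorphism of $\mathfrak h\otimes A$-modules $\varphi:W_A(\lambda)_\lambda\to M$ such that all $\varphi(w)$ satisfy $(*)$, there is a unique homomorphism of $\mathfrak q\otimes A$-modules $\Phi:W_A(\lambda)\to M$ that extends $\varphi$. -/

import Mathlib

open scoped TensorProduct

universe u v w

noncomputable section

namespace QueerWeyl

/-! ### Supervector spaces -/

/-- The sign `(-1)^{ij}` for parities `i, j`. -/
def superSign (i j : ZMod 2) : ℂ := if i = 1 ∧ j = 1 then -1 else 1

/-- The sign `(-1)^i` for a parity `i`. -/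
def paritySign (i : ZMod 2) : ℂ := if i = 0 then 1 else -1

/-- A supervector space: a complex vector space with a decomposition `V = V₀ ⊕ V₁`. -/
class SuperSpace (V : Type u) [AddCommGroup V] [Module ℂ V] where
  /-- the homogeneous component of a given parity -/
  gr : ZMod 2 → Submodule ℂ V
  isCompl_gr : IsCompl (gr 0) (gr 1)

open SuperSpace

theorem zmod_cases : ∀ i : ZMod 2, i = 0 ∨ i = 1 := by decide

theorem one_add_one_zmod : (1 : ZMod 2) + 1 = 0 := by decide

theorem paritySign_add (i j : ZMod 2) : paritySign (i + j) = paritySign i * paritySign j := by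
  rcases zmod_cases i with rfl | rfl <;> rcases zmod_cases j with rfl | rfl <;>
    simp [paritySign, one_add_one_zmod]

theorem paritySign_mul_self (i : ZMod 2) : paritySign i * paritySign i = 1 := by
  rcases zmod_cases i with rfl | rfl <;> simp [paritySign]

section Parity

variable {V : Type u} [AddCommGroup V] [Module ℂ V]

theorem eq_zero_of_eq_neg {x : V} (h : x = -x) : x = 0 := by
  have h2 : (2 : ℂ) • x = 0 := by
    rw [two_smul]; nth_rewrite 1 [h]; simp
  simpa using h2

/-- The grading attached to an involution `s`: the even part is the `1`-eigenspace and the odd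
part the `(-1)`-eigenspace. -/
@[reducible]
def SuperSpace.ofInvolution (s : V →ₗ[ℂ] V) (hs : ∀ x, s (s x) = x) : SuperSpace V where
  gr i := LinearMap.ker (s - paritySign i • LinearMap.id)
  isCompl_gr := by
    constructor
    · rw [Submodule.disjoint_def]
      intro x hx hy
      simp only [paritySign, LinearMap.mem_ker, LinearMap.sub_apply,
        LinearMap.id_apply, sub_eq_zero, if_true, one_smul, one_ne_zero, if_false,
        neg_smul] at hx hy
      exact eq_zero_of_eq_neg (hx.symm.trans hy)
    · rw [codisjoint_iff, eq_top_iff]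
      intro x _
      rw [Submodule.mem_sup]
      refine ⟨(2⁻¹ : ℂ) • (x + s x), ?_, (2⁻¹ : ℂ) • (x - s x), ?_, ?_⟩
      · simp [paritySign, hs, add_comm]
      · simp [paritySign, hs]
      · rw [← smul_add]
        have : x + s x + (x - s x) = (2 : ℂ) • x := by rw [two_smul]; abel
        rw [this, smul_smul]; norm_num

variable [SuperSpace V]

variable (V) in
/-- The parity involution `v₀ + v₁ ↦ v₀ - v₁` of a supervector space. -/
def parity : V →ₗ[ℂ] V :=
  (gr 0).projection (gr 1) isCompl_gr - (gr 1).projection (gr 0) isCompl_gr.symm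

theorem parity_of_mem {i : ZMod 2} {x : V} (hx : x ∈ (gr i : Submodule ℂ V)) :
    parity V x = paritySign i • x := by
  rcases zmod_cases i with rfl | rfl
  · simp [parity, paritySign, Submodule.projection_apply_of_mem_left _ hx,
      (Submodule.projection_apply_eq_zero_iff _).2 hx]
  · simp [parity, paritySign, Submodule.projection_apply_of_mem_left _ hx,
      (Submodule.projection_apply_eq_zero_iff _).2 hx]

theorem exists_homogeneous (x : V) :
    ∃ a ∈ (gr 0 : Submodule ℂ V), ∃ b ∈ (gr 1 : Submodule ℂ V), a + b = x := by
  have h : x ∈ (gr 0 : Submodule ℂ V) ⊔ gr 1 := by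
    rw [isCompl_gr.sup_eq_top]; trivial
  exact Submodule.mem_sup.1 h

/-- A property that is additive and holds for homogeneous elements holds for all elements. -/
theorem homogeneous_induction {p : V → Prop} (h : ∀ i, ∀ x ∈ (gr i : Submodule ℂ V), p x)
    (hadd : ∀ x y, p x → p y → p (x + y)) (x : V) : p x := by
  obtain ⟨a, ha, b, hb, rfl⟩ := exists_homogeneous x
  exact hadd _ _ (h 0 a ha) (h 1 b hb)

theorem parity_parity (x : V) : parity V (parity V x) = x := by
  induction x using homogeneous_induction with
  | h i x hx => rw [parity_of_mem hx, map_smul, parity_of_mem hx, smul_smul,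
      paritySign_mul_self, one_smul]
  | hadd x y hx hy => simp [hx, hy]

theorem mem_gr_iff {i : ZMod 2} {x : V} :
    x ∈ (gr i : Submodule ℂ V) ↔ parity V x = paritySign i • x := by
  refine ⟨parity_of_mem, fun h => ?_⟩
  obtain ⟨a, ha, b, hb, rfl⟩ := exists_homogeneous x
  rw [map_add, parity_of_mem ha, parity_of_mem hb] at h
  rcases zmod_cases i with rfl | rfl
  · have : b = 0 := by
      simp only [paritySign, if_true, one_smul, one_ne_zero, if_false, neg_smul] at h
      exact (eq_zero_of_eq_neg (add_left_cancel h).symm)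
    simpa [this] using ha
  · have : a = 0 := by
      simp only [paritySign, if_true, one_smul, one_ne_zero, if_false, neg_smul, smul_add] at h
      exact (eq_zero_of_eq_neg (add_right_cancel h))
    simpa [this] using hb

end Parity

theorem parity_ofInvolution {V : Type u} [AddCommGroup V] [Module ℂ V] (s : V →ₗ[ℂ] V)
    (hs : ∀ x, s (s x) = x) (x : V) :
    letI := SuperSpace.ofInvolution s hs
    parity V x = s x := by
  let _ := SuperSpace.ofInvolution s hs
  induction x using homogeneous_induction with
  | h i x hx =>
    rw [parity_of_mem hx]
    have h : x ∈ LinearMap.ker (s - paritySign i • LinearMap.id) := hx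
    rw [LinearMap.mem_ker, LinearMap.sub_apply, sub_eq_zero] at h
    exact h.symm
  | hadd x y hx hy => simp [hx, hy]

/-- A linear map of supervector spaces is even if it preserves parity. -/
def IsEvenMap {V : Type u} {W : Type v} [AddCommGroup V] [Module ℂ V] [SuperSpace V]
    [AddCommGroup W] [Module ℂ W] [SuperSpace W] (f : V → W) : Prop :=
  ∀ i, ∀ x ∈ (gr i : Submodule ℂ V), f x ∈ (gr i : Submodule ℂ W)

/-- An additive subgroup is graded if it contains the homogeneous components of its elements. -/
def IsGraded {V : Type u} [AddCommGroup V] [Module ℂ V] [SuperSpace V]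
    (N : AddSubgroup V) : Prop :=
  ∀ a ∈ (gr 0 : Submodule ℂ V), ∀ b ∈ (gr 1 : Submodule ℂ V), a + b ∈ N → a ∈ N ∧ b ∈ N

/-! ### Lie superalgebras -/

/-- A Lie superalgebra over `ℂ`. -/
class LieSuperalgebra (g : Type u) [AddCommGroup g] [Module ℂ g] extends SuperSpace g where
  /-- the superbracket -/
  bracket : g →ₗ[ℂ] g →ₗ[ℂ] g
  bracket_mem : ∀ {i j : ZMod 2} {x y : g}, x ∈ gr i → y ∈ gr j → bracket x y ∈ gr (i + j)
  bracket_skew : ∀ {i j : ZMod 2} {x y : g}, x ∈ gr i → y ∈ gr j →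
    bracket x y = -(superSign i j • bracket y x)
  jacobi : ∀ {i j : ZMod 2} {x y : g}, x ∈ gr i → y ∈ gr j → ∀ z : g,
    bracket x (bracket y z) =
      bracket (bracket x y) z + superSign i j • bracket y (bracket x z)

open LieSuperalgebra

/-- The tensor product `g ⊗ A` of a Lie superalgebra and a commutative algebra, with
`(g ⊗ A)ⱼ = gⱼ ⊗ A` and `[x ⊗ a, y ⊗ b] = [x, y] ⊗ ab`. -/
instance currentAlgebra (g : Type u) [AddCommGroup g] [Module ℂ g] [LieSuperalgebra g]
    (A : Type v) [CommRing A] [Algebra ℂ A] : LieSuperalgebra (g ⊗[ℂ] A) where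
  gr i := LinearMap.range ((gr i : Submodule ℂ g).subtype.rTensor A)
  isCompl_gr := by
    have key : ∀ (i : ZMod 2) (x : g ⊗[ℂ] A),
        x ∈ LinearMap.range ((gr i : Submodule ℂ g).subtype.rTensor A) →
        (parity g).rTensor A x = paritySign i • x := by
      rintro i _ ⟨y, rfl⟩
      induction y with
      | zero => simp
      | tmul a b => simp [parity_of_mem a.2, TensorProduct.smul_tmul']
      | add a b ha hb => simp [ha, hb]
    constructor
    · rw [Submodule.disjoint_def]
      intro x hx hy
      have h0 := key 0 x hx
      have h1 := key 1 x hy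
      simp only [paritySign, if_true, one_smul, one_ne_zero, if_false, neg_smul] at h0 h1
      exact eq_zero_of_eq_neg (h0.symm.trans h1)
    · rw [codisjoint_iff, eq_top_iff]
      intro x _
      induction x with
      | zero => exact zero_mem _
      | tmul a b =>
        obtain ⟨c, hc, d, hd, rfl⟩ := exists_homogeneous a
        rw [TensorProduct.add_tmul]
        exact Submodule.add_mem_sup ⟨(⟨c, hc⟩ : (gr 0 : Submodule ℂ g)) ⊗ₜ b, by simp⟩
          ⟨(⟨d, hd⟩ : (gr 1 : Submodule ℂ g)) ⊗ₜ b, by simp⟩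
      | add a b ha hb => exact add_mem (ha trivial) (hb trivial)
  bracket := TensorProduct.map₂ bracket (LinearMap.mul ℂ A)
  bracket_mem := by
    rintro i j _ _ ⟨x, rfl⟩ ⟨y, rfl⟩
    induction x with
    | zero => simp
    | add a b ha hb => simpa using add_mem ha hb
    | tmul a b =>
      induction y with
      | zero => simp
      | add a b ha hb => simpa using add_mem ha hb
      | tmul c d =>
        exact ⟨(⟨bracket (a : g) (c : g), bracket_mem a.2 c.2⟩ :
          (gr (i + j) : Submodule ℂ g)) ⊗ₜ (b * d), by simp⟩
  bracket_skew := by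
    rintro i j _ _ ⟨x, rfl⟩ ⟨y, rfl⟩
    induction x with
    | zero => simp
    | add a b ha hb => simp only [map_add, LinearMap.add_apply, smul_add, neg_add, ha, hb]
    | tmul a b =>
      induction y with
      | zero => simp
      | add a b ha hb => simp only [map_add, LinearMap.add_apply, smul_add, neg_add, ha, hb]
      | tmul c d =>
        simp only [LinearMap.rTensor_tmul, Submodule.subtype_apply, TensorProduct.map₂_apply_tmul,
          TensorProduct.map_tmul, LinearMap.mul_apply']
        rw [bracket_skew a.2 c.2, TensorProduct.neg_tmul, mul_comm, TensorProduct.smul_tmul']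
  jacobi := by
    rintro i j _ _ ⟨x, rfl⟩ ⟨y, rfl⟩ z
    induction x with
    | zero => simp
    | add a b ha hb =>
      simp only [map_add, LinearMap.add_apply, smul_add, ha, hb]; abel
    | tmul a b =>
      induction y with
      | zero => simp
      | add a b ha hb => 
        simp only [map_add, LinearMap.add_apply, smul_add, ha, hb]; abel
      | tmul c d =>
        induction z with
        | zero => simp
        | add a b ha hb =>
          simp only [map_add, smul_add, ha, hb]; abel
        | tmul e f =>
          simp only [LinearMap.rTensor_tmul, Submodule.subtype_apply,
            TensorProduct.map₂_apply_tmul, TensorProduct.map_tmul, LinearMap.mul_apply']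
          rw [jacobi a.2 c.2, TensorProduct.add_tmul, TensorProduct.smul_tmul', mul_assoc,
            mul_left_comm d b f]

/-! ### The queer Lie superalgebra -/

/-- The underlying space of `q(n)`: the complex `2n × 2n` block matrices
`(X | Y ; Y | X)`. -/
def queerSubmodule (n : ℕ) : Submodule ℂ (Matrix (Fin n ⊕ Fin n) (Fin n ⊕ Fin n) ℂ) where
  carrier := {M | ∃ X Y : Matrix (Fin n) (Fin n) ℂ, M = Matrix.fromBlocks X Y Y X}
  zero_mem' := ⟨0, 0, by simp⟩
  add_mem' := by
    rintro _ _ ⟨X, Y, rfl⟩ ⟨X', Y', rfl⟩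
    exact ⟨X + X', Y + Y', by simp [Matrix.fromBlocks_add]⟩
  smul_mem' := by
    rintro c _ ⟨X, Y, rfl⟩
    exact ⟨c • X, c • Y, by simp [Matrix.fromBlocks_smul]⟩

/-- The queer Lie superalgebra `q(n)`. -/
abbrev Queer (n : ℕ) : Type := queerSubmodule n

namespace Queer

variable {n : ℕ}

/-- The matrix `(X | Y ; Y | X)` as an element of `q(n)`. -/
def mk (X Y : Matrix (Fin n) (Fin n) ℂ) : Queer n := ⟨Matrix.fromBlocks X Y Y X, X, Y, rfl⟩

/-- The diagonal block `X` of `(X | Y ; Y | X)`. -/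
def evenBlock : Queer n →ₗ[ℂ] Matrix (Fin n) (Fin n) ℂ where
  toFun M := M.1.toBlocks₁₁
  map_add' _ _ := rfl
  map_smul' _ _ := rfl

/-- The off-diagonal block `Y` of `(X | Y ; Y | X)`. -/
def oddBlock : Queer n →ₗ[ℂ] Matrix (Fin n) (Fin n) ℂ where
  toFun M := M.1.toBlocks₁₂
  map_add' _ _ := rfl
  map_smul' _ _ := rfl

@[simp] theorem evenBlock_mk (X Y : Matrix (Fin n) (Fin n) ℂ) : evenBlock (mk X Y) = X := rfl

@[simp] theorem oddBlock_mk (X Y : Matrix (Fin n) (Fin n) ℂ) : oddBlock (mk X Y) = Y := rfl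

theorem mk_eta (M : Queer n) : mk (evenBlock M) (oddBlock M) = M := by
  obtain ⟨_, X, Y, rfl⟩ := M; rfl

theorem ext_blocks {M N : Queer n} (h : evenBlock M = evenBlock N)
    (h' : oddBlock M = oddBlock N) : M = N := by
  rw [← mk_eta M, ← mk_eta N, h, h']

/-- The `ℤ/2`-grading of `q(n)`: block-diagonal matrices are even, block-antidiagonal matrices
are odd. -/
instance superSpace (n : ℕ) : SuperSpace (Queer n) where
  gr i := if i = 0 then LinearMap.ker oddBlock else LinearMap.ker evenBlock
  isCompl_gr := by
    constructor
    · rw [Submodule.disjoint_def]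
      intro x hx hy
      simp only [if_true, one_ne_zero, if_false, LinearMap.mem_ker] at hx hy
      exact ext_blocks (by simpa using hy) (by simpa using hx)
    · rw [codisjoint_iff, eq_top_iff]
      intro x _
      rw [Submodule.mem_sup]
      exact ⟨mk (evenBlock x) 0, by simp, mk 0 (oddBlock x), by simp,
        ext_blocks (by simp) (by simp)⟩

/-- The superbracket of `q(n) ⊆ gl(n|n)`. For homogeneous `M, N` it is the supercommutator
`MN - (-1)^{|M||N|} NM` of matrices, see `coe_bracket`. -/
def superBracket : Queer n →ₗ[ℂ] Queer n →ₗ[ℂ] Queer n :=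
  LinearMap.mk₂ ℂ
    (fun M N => mk
      (evenBlock M * evenBlock N - evenBlock N * evenBlock M
        + oddBlock M * oddBlock N + oddBlock N * oddBlock M)
      (evenBlock M * oddBlock N - oddBlock N * evenBlock M
        + oddBlock M * evenBlock N - evenBlock N * oddBlock M))
    (fun _ _ _ => ext_blocks (by simp; noncomm_ring) (by simp; noncomm_ring))
    (fun _ _ _ => ext_blocks (by simp [smul_sub, smul_add]) (by simp [smul_sub, smul_add]))
    (fun _ _ _ => ext_blocks (by simp; noncomm_ring) (by simp; noncomm_ring))
    (fun _ _ _ => ext_blocks (by simp [smul_sub, smul_add]) (by simp [smul_sub, smul_add]))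

@[simp] theorem evenBlock_superBracket (M N : Queer n) : evenBlock (superBracket M N) =
    evenBlock M * evenBlock N - evenBlock N * evenBlock M
        + oddBlock M * oddBlock N + oddBlock N * oddBlock M := rfl

@[simp] theorem oddBlock_superBracket (M N : Queer n) : oddBlock (superBracket M N) =
    evenBlock M * oddBlock N - oddBlock N * evenBlock M
        + oddBlock M * evenBlock N - evenBlock N * oddBlock M := rfl

theorem coe_bracket {i j : ZMod 2} {M N : Queer n} (hM : M ∈ (gr i : Submodule ℂ (Queer n)))
    (hN : N ∈ (gr j : Submodule ℂ (Queer n))) :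
    (superBracket M N).1 = M.1 * N.1 - superSign i j • (N.1 * M.1) := by
  obtain ⟨X, Y, rfl⟩ : ∃ X Y, M = mk X Y := ⟨_, _, (mk_eta M).symm⟩
  obtain ⟨X', Y', rfl⟩ : ∃ X Y, N = mk X Y := ⟨_, _, (mk_eta N).symm⟩
  rw [← mk_eta (superBracket _ _)]
  rcases zmod_cases i with rfl | rfl <;> rcases zmod_cases j with rfl | rfl <;>
    simp only [gr, if_true, one_ne_zero, if_false, LinearMap.mem_ker, evenBlock_mk,
      oddBlock_mk] at hM hN <;> subst hM hN <;>
    rw [evenBlock_superBracket, oddBlock_superBracket] <;>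
    simp only [evenBlock_mk, oddBlock_mk] <;>
    simp [mk, superSign, Matrix.fromBlocks_multiply, sub_eq_add_neg,
      Matrix.fromBlocks_add, Matrix.fromBlocks_neg]

instance lieSuperalgebra (n : ℕ) : LieSuperalgebra (Queer n) where
  bracket := superBracket
  bracket_mem := by
    intro i j M N hM hN
    rcases zmod_cases i with rfl | rfl <;> rcases zmod_cases j with rfl | rfl <;>
    simp only [gr, if_true, one_ne_zero, if_false, LinearMap.mem_ker] at hM hN <;>
    simp [gr, hM, hN, one_add_one_zmod]
  bracket_skew := by
    intro i j M N hM hN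
    rcases zmod_cases i with rfl | rfl <;> rcases zmod_cases j with rfl | rfl <;>
    simp only [gr, if_true, one_ne_zero, if_false, LinearMap.mem_ker] at hM hN <;>
    exact ext_blocks (by simp [hM, hN, superSign, add_comm])
      (by simp [hM, hN, superSign, add_comm])
  jacobi := by
    intro i j M N hM hN Z
    rcases zmod_cases i with rfl | rfl <;> rcases zmod_cases j with rfl | rfl <;>
    simp only [gr, if_true, one_ne_zero, if_false, LinearMap.mem_ker] at hM hN <;>
    exact ext_blocks (by simp [hM, hN, superSign]; noncomm_ring)
      (by simp [hM, hN, superSign]; noncomm_ring)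

end Queer

/-! ### Universal enveloping superalgebras -/

section Enveloping

variable (g : Type u) [AddCommGroup g] [Module ℂ g] [LieSuperalgebra g]

/-- The defining relations `x y - (-1)^{|x||y|} y x = [x, y]` of the universal enveloping
superalgebra. -/
inductive EnvRel : TensorAlgebra ℂ g → TensorAlgebra ℂ g → Prop
  | super_comm {i j : ZMod 2} {x y : g} (hx : x ∈ (gr i : Submodule ℂ g))
      (hy : y ∈ (gr j : Submodule ℂ g)) :
      EnvRel (TensorAlgebra.ι ℂ x * TensorAlgebra.ι ℂ y)
        (TensorAlgebra.ι ℂ (bracket x y) +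
          superSign i j • (TensorAlgebra.ι ℂ y * TensorAlgebra.ι ℂ x))

/-- The universal enveloping superalgebra `U(g)`. -/
def Env : Type u := RingQuot (EnvRel g)

instance : Ring (Env g) := inferInstanceAs (Ring (RingQuot (EnvRel g)))

instance : Algebra ℂ (Env g) := inferInstanceAs (Algebra ℂ (RingQuot (EnvRel g)))

namespace Env

variable {g}

/-- The canonical map `g → U(g)`. -/
def ι : g →ₗ[ℂ] Env g :=
  (RingQuot.mkAlgHom ℂ (EnvRel g)).toLinearMap ∘ₗ TensorAlgebra.ι ℂ

theorem ι_mul_ι {i j : ZMod 2} {x y : g} (hx : x ∈ (gr i : Submodule ℂ g))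
    (hy : y ∈ (gr j : Submodule ℂ g)) :
    (ι x * ι y : Env g) = ι (bracket x y) + superSign i j • (ι y * ι x) := by
  have h := RingQuot.mkAlgHom_rel ℂ (EnvRel.super_comm hx hy)
  rw [map_mul, map_add, map_smul, map_mul] at h
  exact h

/-- The universal property of `U(g)`. -/
def lift {B : Type v} [Ring B] [Algebra ℂ B] (f : g →ₗ[ℂ] B)
    (hf : ∀ {i j : ZMod 2} {x y : g}, x ∈ (gr i : Submodule ℂ g) → y ∈ (gr j : Submodule ℂ g) →
      f x * f y = f (bracket x y) + superSign i j • (f y * f x)) : Env g →ₐ[ℂ] B :=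
  RingQuot.liftAlgHom ℂ ⟨TensorAlgebra.lift ℂ f, by
    rintro _ _ ⟨hx, hy⟩
    simpa using hf hx hy⟩

@[simp] theorem lift_ι {B : Type v} [Ring B] [Algebra ℂ B] (f : g →ₗ[ℂ] B)
    (hf : ∀ {i j : ZMod 2} {x y : g}, x ∈ (gr i : Submodule ℂ g) → y ∈ (gr j : Submodule ℂ g) →
      f x * f y = f (bracket x y) + superSign i j • (f y * f x)) (x : g) :
    lift f hf (ι x) = f x := by
  have h := RingQuot.liftAlgHom_mkAlgHom_apply ℂ (TensorAlgebra.lift ℂ f) (s := EnvRel g) (by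
    rintro _ _ ⟨hx, hy⟩
    simpa using hf hx hy) (TensorAlgebra.ι ℂ x)
  rw [TensorAlgebra.lift_ι_apply] at h
  exact h

theorem algHom_ext {B : Type v} [Ring B] [Algebra ℂ B] {f f' : Env g →ₐ[ℂ] B}
    (h : ∀ x, f (ι x) = f' (ι x)) : f = f' := by
  apply RingQuot.ringQuot_ext'
  apply TensorAlgebra.hom_ext
  ext x
  exact h x

theorem parityHom_aux {i j : ZMod 2} {x y : g} (hx : x ∈ (gr i : Submodule ℂ g))
    (hy : y ∈ (gr j : Submodule ℂ g)) :
    (ι ∘ₗ parity g : g →ₗ[ℂ] Env g) x * (ι ∘ₗ parity g : g →ₗ[ℂ] Env g) y =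
      (ι ∘ₗ parity g : g →ₗ[ℂ] Env g) (bracket x y) +
        superSign i j •
          ((ι ∘ₗ parity g : g →ₗ[ℂ] Env g) y * (ι ∘ₗ parity g : g →ₗ[ℂ] Env g) x) := by
  have e : ((paritySign i * paritySign j) • (ι x * ι y) : Env g) =
      (paritySign i * paritySign j) • (ι (bracket x y) + superSign i j • (ι y * ι x)) := by
    rw [ι_mul_ι hx hy]
  simp only [LinearMap.comp_apply, parity_of_mem hx, parity_of_mem hy,
    parity_of_mem (bracket_mem hx hy), map_smul, smul_mul_smul_comm, paritySign_add]
  rw [e, smul_add, smul_smul, smul_smul]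
  congr 2
  ring

/-- The parity automorphism of `U(g)`, extending the parity involution of `g`. -/
def parityHom : Env g →ₐ[ℂ] Env g := lift (ι ∘ₗ parity g) parityHom_aux

@[simp] theorem parityHom_ι (x : g) : parityHom (ι x) = ι (parity g x) :=
  lift_ι (ι ∘ₗ parity g) parityHom_aux x

theorem parityHom_parityHom (a : Env g) : parityHom (parityHom a) = a := by
  have h : (parityHom.comp parityHom : Env g →ₐ[ℂ] Env g) = AlgHom.id ℂ (Env g) :=
    algHom_ext (fun x => by simp [parity_parity])
  exact DFunLike.congr_fun h a

/-- The `ℤ/2`-grading of `U(g)`, for which products of `r` odd and any number of even elements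
of `g` have parity `r`. -/
instance : SuperSpace (Env g) :=
  SuperSpace.ofInvolution parityHom.toLinearMap parityHom_parityHom

theorem parity_apply (a : Env g) : parity (Env g) a = parityHom a :=
  parity_ofInvolution parityHom.toLinearMap parityHom_parityHom a

theorem map_aux {k : Type v} [AddCommGroup k] [Module ℂ k] [LieSuperalgebra k] (f : g →ₗ[ℂ] k)
    (hf : IsEvenMap f) (hf' : ∀ x y, f (bracket x y) = bracket (f x) (f y)) {i j : ZMod 2}
    {x y : g} (hx : x ∈ (gr i : Submodule ℂ g)) (hy : y ∈ (gr j : Submodule ℂ g)) :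
    (ι ∘ₗ f : g →ₗ[ℂ] Env k) x * (ι ∘ₗ f : g →ₗ[ℂ] Env k) y =
      (ι ∘ₗ f : g →ₗ[ℂ] Env k) (bracket x y) +
        superSign i j • ((ι ∘ₗ f : g →ₗ[ℂ] Env k) y * (ι ∘ₗ f : g →ₗ[ℂ] Env k) x) := by
  simpa [hf'] using ι_mul_ι (hf i x hx) (hf j y hy)

/-- The homomorphism `U(g) → U(k)` induced by a homomorphism `g → k` of Lie superalgebras. -/
def map {k : Type v} [AddCommGroup k] [Module ℂ k] [LieSuperalgebra k] (f : g →ₗ[ℂ] k)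
    (hf : IsEvenMap f) (hf' : ∀ x y, f (bracket x y) = bracket (f x) (f y)) :
    Env g →ₐ[ℂ] Env k :=
  lift (ι ∘ₗ f) (map_aux f hf hf')

theorem map_ι {k : Type v} [AddCommGroup k] [Module ℂ k] [LieSuperalgebra k] (f : g →ₗ[ℂ] k)
    (hf : IsEvenMap f) (hf' : ∀ x y, f (bracket x y) = bracket (f x) (f y)) (x : g) :
    map f hf hf' (ι x) = ι (f x) :=
  lift_ι (ι ∘ₗ f) (map_aux f hf hf') x

end Env

end Enveloping

/-! ### Supermodules -/

section Modules

variable (g : Type u) [AddCommGroup g] [Module ℂ g] [LieSuperalgebra g]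

/-- A left `U(g)`-module with a `ℤ/2`-grading is a supermodule if `gᵢ Mⱼ ⊆ Mᵢ₊ⱼ`. -/
class IsSuperModule (M : Type v) [AddCommGroup M] [Module ℂ M] [Module (Env g) M]
    [IsScalarTower ℂ (Env g) M] [SuperSpace M] : Prop where
  smul_mem : ∀ {i j : ZMod 2} {x : g} {m : M}, x ∈ (gr i : Submodule ℂ g) →
    m ∈ (gr j : Submodule ℂ M) → Env.ι x • m ∈ (gr (i + j) : Submodule ℂ M)

variable {g}

theorem parity_ι_smul {M : Type v} [AddCommGroup M] [Module ℂ M] [Module (Env g) M]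
    [IsScalarTower ℂ (Env g) M] [SuperSpace M] [IsSuperModule g M] (x : g) (m : M) :
    parity M (Env.ι x • m) = Env.ι (parity g x) • parity M m := by
  induction x using homogeneous_induction with
  | hadd x y hx hy => simp [add_smul, hx, hy]
  | h i x hx =>
    induction m using homogeneous_induction with
    | hadd m m' hm hm' => simp [smul_add, hm, hm']
    | h j m hm =>
      rw [parity_of_mem (IsSuperModule.smul_mem hx hm), parity_of_mem hx, parity_of_mem hm,
        map_smul, paritySign_add, smul_assoc, smul_comm (Env.ι x), smul_smul]

theorem isSuperModule_of_parity {M : Type v} [AddCommGroup M] [Module ℂ M] [Module (Env g) M]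
    [IsScalarTower ℂ (Env g) M] [SuperSpace M]
    (h : ∀ (x : g) (m : M), parity M (Env.ι x • m) = Env.ι (parity g x) • parity M m) :
    IsSuperModule g M where
  smul_mem := by
    intro i j x m hx hm
    rw [mem_gr_iff, h, parity_of_mem hx, parity_of_mem hm, map_smul, paritySign_add,
      smul_assoc, smul_comm (Env.ι x), smul_smul]

theorem parity_smul {M : Type v} [AddCommGroup M] [Module ℂ M] [Module (Env g) M]
    [IsScalarTower ℂ (Env g) M] [SuperSpace M] [IsSuperModule g M] (a : Env g) (m : M) :
    parity M (a • m) = Env.parityHom a • parity M m := by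
  let s : Module.End ℂ M := parity M
  have hs : ∀ m, s (s m) = m := parity_parity
  let ρ : Env g →ₐ[ℂ] Module.End ℂ M := Algebra.lsmul ℂ ℂ M
  let c : Module.End ℂ M →ₐ[ℂ] Module.End ℂ M :=
    AlgHom.ofLinearMap (LinearMap.mulLeft ℂ s ∘ₗ LinearMap.mulRight ℂ s)
      (by ext m; simp [hs]) (by intro a b; ext m; simp [hs])
  have key : c.comp ρ = ρ.comp Env.parityHom := by
    apply Env.algHom_ext
    intro x
    ext m
    simp only [AlgHom.comp_apply, Env.parityHom_ι]
    change s (Env.ι x • s m) = Env.ι (parity g x) • m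
    rw [parity_ι_smul]
    congr 1
    exact hs m
  have h := DFunLike.congr_fun (DFunLike.congr_fun key a) (s m)
  change s (a • s (s m)) = _ at h
  rw [hs] at h
  exact h

end Modules

/-! ### Free modules, and quotients by graded submodules -/

section Free

variable (g : Type u) [AddCommGroup g] [Module ℂ g] [LieSuperalgebra g]
variable (V : Type v) [AddCommGroup V] [Module ℂ V] [SuperSpace V]

/-- The free `U(g)`-supermodule `U(g) ⊗ V` on a supervector space `V`. -/
abbrev FreeMod : Type (max u v) := Env g ⊗[ℂ] V

theorem freeMod_involution (x : FreeMod g V) :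
    TensorProduct.map (parity (Env g)) (parity V)
      (TensorProduct.map (parity (Env g)) (parity V) x) = x := by
  induction x using TensorProduct.induction_on with
  | zero => simp
  | tmul a b => simp [parity_parity]
  | add a b ha hb => simp [ha, hb]

/-- The grading of `U(g) ⊗ V` as a tensor product of supervector spaces: its parity involution is
the tensor product of the parity involutions of the factors. -/
instance : SuperSpace (FreeMod g V) :=
  SuperSpace.ofInvolution (TensorProduct.map (parity (Env g)) (parity V))
    (freeMod_involution g V)

variable {g V}

theorem parity_tmul (a : Env g) (v : V) :
    parity (FreeMod g V) (a ⊗ₜ v) = Env.parityHom a ⊗ₜ parity V v := by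
  rw [← Env.parity_apply]
  exact parity_ofInvolution (TensorProduct.map (parity (Env g)) (parity V))
    (freeMod_involution g V) (a ⊗ₜ v)

instance : IsSuperModule g (FreeMod g V) :=
  isSuperModule_of_parity (by
    intro x m
    induction m using TensorProduct.induction_on with
    | zero => simp
    | tmul a b => simp [TensorProduct.smul_tmul', parity_tmul]
    | add a b ha hb => simp [ha, hb])

end Free

section Quotient

variable {g : Type u} [AddCommGroup g] [Module ℂ g] [LieSuperalgebra g]
variable {M : Type v} [AddCommGroup M] [Module ℂ M] [Module (Env g) M]
    [IsScalarTower ℂ (Env g) M] [SuperSpace M]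

theorem isGraded_of_parity {N : AddSubgroup M} (hc : ∀ (c : ℂ), ∀ m ∈ N, c • m ∈ N)
    (h : ∀ m ∈ N, parity M m ∈ N) : IsGraded N := by
  intro a ha b hb hab
  have h1 := h _ hab
  rw [map_add, parity_of_mem ha, parity_of_mem hb] at h1
  simp only [paritySign, if_true, one_smul, one_ne_zero, if_false, neg_smul] at h1
  have h2 : a ∈ N := by
    have h3 := hc 2⁻¹ _ (N.add_mem hab h1)
    have h4 : a + b + (a + -b) = (2 : ℂ) • a := by rw [two_smul]; abel
    rw [h4, smul_smul] at h3
    simpa using h3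
  exact ⟨h2, by simpa using N.sub_mem hab h2⟩

theorem IsGraded.parity_mem {N : AddSubgroup M} (h : IsGraded N) {m : M} (hm : m ∈ N) :
    parity M m ∈ N := by
  obtain ⟨a, ha, b, hb, rfl⟩ := exists_homogeneous m
  obtain ⟨h1, h2⟩ := h a ha b hb hm
  rw [map_add, parity_of_mem ha, parity_of_mem hb]
  simpa [paritySign, sub_eq_add_neg] using N.sub_mem h1 h2

theorem isGraded_span [IsSuperModule g M] {R : Set M}
    (hR : ∀ m ∈ R, parity M m ∈ Submodule.span (Env g) R) :
    IsGraded (Submodule.span (Env g) R).toAddSubgroup := by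
  refine isGraded_of_parity ?_ ?_
  · intro c m hm
    have h := (Submodule.span (Env g) R).smul_mem (algebraMap ℂ (Env g) c) hm
    rwa [algebraMap_smul] at h
  · intro m hm
    induction hm using Submodule.span_induction with
    | mem x hx => exact hR x hx
    | zero => rw [map_zero]; exact zero_mem _
    | add x y _ _ hx hy => rw [map_add]; exact add_mem hx hy
    | smul a x _ hx =>
      rw [parity_smul]
      exact (Submodule.span (Env g) R).smul_mem _ hx

/-- The grading of the quotient of a supermodule by a graded submodule. -/
@[reducible]
def quotientSuperSpace (N : Submodule (Env g) M) (hN : IsGraded N.toAddSubgroup) :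
    SuperSpace (M ⧸ N) where
  gr i := (gr i : Submodule ℂ M).map (N.mkQ.restrictScalars ℂ)
  isCompl_gr := by
    constructor
    · rw [Submodule.disjoint_def]
      rintro _ ⟨a, ha, rfl⟩ ⟨b, hb, hab⟩
      have h1 : a + -b ∈ N := by
        rw [← sub_eq_add_neg]
        exact (Submodule.Quotient.eq N).1 hab.symm
      exact (Submodule.Quotient.mk_eq_zero N).2 (hN a ha (-b) (neg_mem hb) h1).1
    · rw [codisjoint_iff, eq_top_iff]
      intro x _
      obtain ⟨m, rfl⟩ := N.mkQ_surjective x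
      obtain ⟨a, ha, b, hb, rfl⟩ := exists_homogeneous m
      rw [map_add]
      exact Submodule.add_mem_sup ⟨a, ha, rfl⟩ ⟨b, hb, rfl⟩

theorem quotient_isSuperModule [IsSuperModule g M] (N : Submodule (Env g) M)
    (hN : IsGraded N.toAddSubgroup) :
    let _ := quotientSuperSpace N hN
    IsSuperModule g (M ⧸ N) :=
  let _ := quotientSuperSpace N hN
  { smul_mem := by
      rintro i j x _ hx ⟨m, hm, rfl⟩
      exact ⟨Env.ι x • m, IsSuperModule.smul_mem hx hm, rfl⟩ }

end Quotient

/-! ### Triangular decomposition, weights and roots of `q(n)` -/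

namespace Queer

/-- The standard Cartan subalgebra `h = h₀ ⊕ h₁`: both blocks are diagonal. -/
def cartan (n : ℕ) : Submodule ℂ (Queer n) where
  carrier := {M | (evenBlock M).IsDiag ∧ (oddBlock M).IsDiag}
  zero_mem' := by simp
  add_mem' := fun ha hb => by
    simpa using ⟨ha.1.add hb.1, ha.2.add hb.2⟩
  smul_mem' := fun c _ ha => by
    simpa using ⟨ha.1.smul c, ha.2.smul c⟩

/-- The even part `h₀` of the Cartan subalgebra. -/
def cartanEven (n : ℕ) : Submodule ℂ (Queer n) := cartan n ⊓ gr 0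

/-- The subalgebra `n⁺`: both blocks are strictly upper triangular. -/
def nPlus (n : ℕ) : Submodule ℂ (Queer n) where
  carrier := {M | ∀ i j, j ≤ i → evenBlock M i j = 0 ∧ oddBlock M i j = 0}
  zero_mem' := by simp
  add_mem' := fun ha hb i j hij => by
    simp [(ha i j hij).1, (ha i j hij).2, (hb i j hij).1, (hb i j hij).2]
  smul_mem' := fun c _ ha i j hij => by
    simp [(ha i j hij).1, (ha i j hij).2]

variable {n : ℕ}

/-- The even basis element `(E_{ij} | 0 ; 0 | E_{ij})`. -/
def evenE (i j : Fin n) : Queer n := mk (Matrix.single i j 1) 0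

/-- The odd basis element `(0 | E_{ij} ; E_{ij} | 0)`. -/
def oddE (i j : Fin n) : Queer n := mk 0 (Matrix.single i j 1)

/-- The basis element `k_i` of `h₀`. -/
def kEven (i : Fin n) : cartanEven n :=
  ⟨evenE i i, ⟨by
    intro a b hab
    simp only [evenE, evenBlock_mk, Matrix.single_apply]
    rw [if_neg]
    rintro ⟨rfl, rfl⟩
    exact hab rfl, by simp [evenE]⟩, by simp [evenE, gr]⟩

/-- The functional `ε_i` on `h₀`, the `i`-th diagonal entry. -/
def epsilon (i : Fin n) : Module.Dual ℂ (cartanEven n) where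
  toFun h := evenBlock (h : Queer n) i i
  map_add' _ _ := by simp
  map_smul' _ _ := by simp

theorem parity_mk (X Y : Matrix (Fin n) (Fin n) ℂ) : parity (Queer n) (mk X Y) = mk X (-Y) := by
  have h : mk X Y = mk X 0 + mk 0 Y := ext_blocks (by simp) (by simp)
  have h0 : mk X 0 ∈ (gr 0 : Submodule ℂ (Queer n)) := by simp [gr]
  have h1 : mk 0 Y ∈ (gr 1 : Submodule ℂ (Queer n)) := by simp [gr]
  rw [h, map_add, parity_of_mem h0, parity_of_mem h1]
  exact ext_blocks (by simp [paritySign]) (by simp [paritySign])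

theorem parity_eq (M : Queer n) : parity (Queer n) M = mk (evenBlock M) (-oddBlock M) := by
  rw [← parity_mk, mk_eta]

theorem parity_mem_cartan {M : Queer n} (hM : M ∈ cartan n) : parity (Queer n) M ∈ cartan n := by
  rw [parity_eq]
  exact ⟨hM.1, by simpa using hM.2.neg⟩

theorem parity_mem_nPlus {M : Queer n} (hM : M ∈ nPlus n) : parity (Queer n) M ∈ nPlus n := by
  rw [parity_eq]
  intro i j hij
  simpa using hM i j hij

theorem parity_cartanEven (h : cartanEven n) : parity (Queer n) (h : Queer n) = h := by
  rw [parity_of_mem (i := 0) h.2.2]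
  simp [paritySign]

theorem parity_evenE (i j : Fin n) : parity (Queer n) (evenE i j) = evenE i j := by
  rw [evenE, parity_mk, neg_zero]

/-- The monoid `Q⁺` of nonnegative integer combinations of the simple roots
`α_i = ε_i - ε_{i+1}`. -/
def rootMonoid (n : ℕ) : AddSubmonoid (Module.Dual ℂ (cartanEven n)) :=
  AddSubmonoid.closure {α | ∃ i j : Fin n, (j : ℕ) = i + 1 ∧ α = epsilon i - epsilon j}

/-- The set `Λ⁺` of dominant integral weights of `q(n)`: with `λ_i = λ(k_i)`, each
`λ_i - λ_{i+1}` is a nonnegative integer, and it vanishes only if `λ_i = λ_{i+1} = 0`. -/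
def dominantWeights (n : ℕ) : Set (Module.Dual ℂ (cartanEven n)) :=
  {lam | ∀ i j : Fin n, (j : ℕ) = i + 1 →
    (∃ m : ℕ, lam (kEven i) - lam (kEven j) = m) ∧
    (lam (kEven i) = lam (kEven j) → lam (kEven i) = 0 ∧ lam (kEven j) = 0)}

end Queer

open Queer

/-! ### Weight spaces -/

section Weights

variable {n : ℕ}

/-- The Lie superalgebra `q(n) ⊗ A`. -/
abbrev Current (n : ℕ) (A : Type v) [CommRing A] [Algebra ℂ A] : Type v := Queer n ⊗[ℂ] A

variable (n) in
/-- The inclusion `q(n) → q(n) ⊗ A`, `x ↦ x ⊗ 1`. -/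
def incl (A : Type v) [CommRing A] [Algebra ℂ A] : Queer n →ₗ[ℂ] Current n A :=
  (TensorProduct.mk ℂ (Queer n) A).flip 1

theorem incl_apply (A : Type v) [CommRing A] [Algebra ℂ A] (x : Queer n) :
    incl n A x = x ⊗ₜ 1 := rfl

theorem incl_even (A : Type v) [CommRing A] [Algebra ℂ A] : IsEvenMap (incl n A) :=
  fun i x hx => ⟨(⟨x, hx⟩ : (gr i : Submodule ℂ (Queer n))) ⊗ₜ 1, rfl⟩

theorem incl_bracket (A : Type v) [CommRing A] [Algebra ℂ A] (x y : Queer n) :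
    incl n A (bracket x y) =
      (currentAlgebra (Queer n) A).bracket (incl n A x) (incl n A y) := by
  change (bracket x y : Queer n) ⊗ₜ[ℂ] (1 : A) = (bracket x y : Queer n) ⊗ₜ[ℂ] ((1 : A) * 1)
  rw [mul_one]

theorem parity_map {V : Type u} {W : Type v} [AddCommGroup V] [Module ℂ V] [SuperSpace V]
    [AddCommGroup W] [Module ℂ W] [SuperSpace W] {f : V →ₗ[ℂ] W} (hf : IsEvenMap f) (x : V) :
    parity W (f x) = f (parity V x) := by
  induction x using homogeneous_induction with
  | h i x hx => rw [parity_of_mem (hf i x hx), parity_of_mem hx, map_smul]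
  | hadd x y hx hy => simp [hx, hy]

variable (g : Type u) [AddCommGroup g] [Module ℂ g] [LieSuperalgebra g]

/-- The weight space `M_μ = {m | h m = μ(h) m for all h ∈ h₀}` of a `g`-module `M`, where `q(n)`
acts through a map `c : q(n) → g`. -/
def weightSpaceOf (c : Queer n →ₗ[ℂ] g) (M : Type v) [AddCommGroup M] [Module ℂ M]
    [Module (Env g) M] [IsScalarTower ℂ (Env g) M] (μ : Module.Dual ℂ (cartanEven n)) :
    Submodule ℂ M where
  carrier := {m | ∀ h : cartanEven n, Env.ι (c h) • m = μ h • m}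
  zero_mem' := by simp
  add_mem' := fun ha hb h => by rw [smul_add, smul_add, ha h, hb h]
  smul_mem' := fun r _ ha h => by rw [smul_comm, ha h, smul_comm]

variable {g} in
theorem parity_mem_weightSpace {c : Queer n →ₗ[ℂ] g} (hc : IsEvenMap c) {M : Type v}
    [AddCommGroup M] [Module ℂ M] [Module (Env g) M] [IsScalarTower ℂ (Env g) M] [SuperSpace M]
    [IsSuperModule g M] {μ : Module.Dual ℂ (cartanEven n)} {m : M}
    (hm : m ∈ weightSpaceOf g c M μ) : parity M m ∈ weightSpaceOf g c M μ := by
  intro h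
  have e := congrArg (parity M) (hm h)
  rwa [parity_ι_smul, parity_map hc, parity_cartanEven, map_smul] at e

/-- The grading of a graded subspace. -/
@[reducible]
def subSuperSpace {V : Type v} [AddCommGroup V] [Module ℂ V] [SuperSpace V] (N : Submodule ℂ V)
    (hN : ∀ x ∈ N, parity V x ∈ N) : SuperSpace N where
  gr i := (gr i : Submodule ℂ V).comap N.subtype
  isCompl_gr := by
    constructor
    · rw [Submodule.disjoint_def]
      intro x hx hy
      exact Subtype.ext ((Submodule.disjoint_def.1 (isCompl_gr (V := V)).disjoint) _ hx hy)
    · rw [codisjoint_iff, eq_top_iff]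
      rintro ⟨x, hx⟩ _
      obtain ⟨a, ha, b, hb, rfl⟩ := exists_homogeneous x
      have h2 := hN _ hx
      rw [map_add, parity_of_mem ha, parity_of_mem hb] at h2
      simp only [paritySign, if_true, one_smul, one_ne_zero, if_false, neg_smul] at h2
      have h3 : a ∈ N := by
        have h4 := N.smul_mem (2⁻¹ : ℂ) (N.add_mem hx h2)
        have h5 : a + b + (a + -b) = (2 : ℂ) • a := by rw [two_smul]; abel
        rw [h5, smul_smul] at h4
        simpa using h4
      have h4 : b ∈ N := by simpa using N.sub_mem hx h3
      exact Submodule.mem_sup.2 ⟨⟨a, h3⟩, ha, ⟨b, h4⟩, hb, rfl⟩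

/-- The weight space `M_μ` of a `q(n) ⊗ A`-module `M`. -/
abbrev weightSpace (A : Type u) [CommRing A] [Algebra ℂ A] (M : Type v) [AddCommGroup M]
    [Module ℂ M] [Module (Env (Current n A)) M] [IsScalarTower ℂ (Env (Current n A)) M]
    (μ : Module.Dual ℂ (cartanEven n)) : Submodule ℂ M :=
  weightSpaceOf (Current n A) (incl n A) M μ

instance weightSpaceSuperSpace (A : Type u) [CommRing A] [Algebra ℂ A] (M : Type v)
    [AddCommGroup M] [Module ℂ M] [Module (Env (Current n A)) M]
    [IsScalarTower ℂ (Env (Current n A)) M] [SuperSpace M]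
    [IsSuperModule (Current n A) M] (μ : Module.Dual ℂ (cartanEven n)) :
    SuperSpace (weightSpace A M μ) :=
  subSuperSpace _ (fun _ => parity_mem_weightSpace (incl_even A))

/-- The weight space `L_μ` of a `q(n)`-module `L`. -/
abbrev queerWeightSpace (L : Type u) [AddCommGroup L] [Module ℂ L] [Module (Env (Queer n)) L]
    [IsScalarTower ℂ (Env (Queer n)) L] (μ : Module.Dual ℂ (cartanEven n)) : Submodule ℂ L :=
  weightSpaceOf (Queer n) LinearMap.id L μ

instance queerWeightSpaceSuperSpace (L : Type u) [AddCommGroup L] [Module ℂ L]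
    [Module (Env (Queer n)) L] [IsScalarTower ℂ (Env (Queer n)) L] [SuperSpace L]
    [IsSuperModule (Queer n) L] (μ : Module.Dual ℂ (cartanEven n)) :
    SuperSpace (queerWeightSpace L μ) :=
  subSuperSpace _ (fun _ => parity_mem_weightSpace (fun _ _ h => h))

end Weights

/-! ### Irreducible highest weight modules -/

section HighestWeight

variable {n : ℕ} (L : Type u) [AddCommGroup L] [Module ℂ L] [Module (Env (Queer n)) L]
  [IsScalarTower ℂ (Env (Queer n)) L] [SuperSpace L] [IsSuperModule (Queer n) L]
  (lam : Module.Dual ℂ (cartanEven n))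

/-- `L` is a highest weight `q(n)`-module of highest weight `λ`. Weight spaces of different weights
are always independent, so that `iSup_eq_top` says that `L` is a weight module. -/
structure IsHighestWeight : Prop where
  iSup_eq_top : ⨆ μ : Module.Dual ℂ (cartanEven n), queerWeightSpace L μ = ⊤
  ne_bot : queerWeightSpace L lam ≠ ⊥
  finite : FiniteDimensional ℂ (queerWeightSpace L lam)
  span_eq_top : Submodule.span (Env (Queer n)) (queerWeightSpace L lam : Set L) = ⊤
  raise : ∀ i j : Fin n, (j : ℕ) = i + 1 → ∀ v ∈ queerWeightSpace L lam,
    (Env.ι (evenE i j) : Env (Queer n)) • v = 0 ∧ (Env.ι (oddE i j) : Env (Queer n)) • v = 0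

/-- `L` is an irreducible highest weight `q(n)`-supermodule of highest weight `λ`, in other words
one of the (two, up to even isomorphism) modules `L(λ)`. -/
structure IsIrreducibleHighestWeight : Prop extends IsHighestWeight L lam where
  eq_bot_or_top : ∀ N : Submodule (Env (Queer n)) L, IsGraded N.toAddSubgroup → N = ⊥ ∨ N = ⊤

/-! ### The module `L̄(λ)` -/

/-- The defining relations of `L̄(λ)`: the generating space `L(λ)_λ` keeps its structure of a module
over `h`, and `n⁺ k = 0`, `h k = λ(h) k` for `h ∈ h₀`, `f_i^{λ(h_i)+1} k = 0`. -/
inductive LbarRel : FreeMod (Queer n) (queerWeightSpace L lam) → Prop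
  | cartan (x : Queer n) (hx : x ∈ cartan n) (k k' : queerWeightSpace L lam)
      (hk : (Env.ι x : Env (Queer n)) • (k : L) = k') :
      LbarRel (Env.ι x ⊗ₜ k - 1 ⊗ₜ k')
  | nPlus (x : Queer n) (hx : x ∈ nPlus n) (k : queerWeightSpace L lam) :
      LbarRel (Env.ι x ⊗ₜ k)
  | weight (h : cartanEven n) (k : queerWeightSpace L lam) :
      LbarRel (Env.ι (h : Queer n) ⊗ₜ k - lam h • (1 ⊗ₜ k))
  | lower (i j : Fin n) (hij : (j : ℕ) = i + 1) (m : ℕ)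
      (hm : lam (kEven i) - lam (kEven j) = m) (k : queerWeightSpace L lam) :
      LbarRel (((Env.ι (evenE j i) : Env (Queer n)) ^ (m + 1)) ⊗ₜ k)

/-- The submodule of relations of `L̄(λ)`. -/
def lbarSub : Submodule (Env (Queer n)) (FreeMod (Queer n) (queerWeightSpace L lam)) :=
  Submodule.span (Env (Queer n)) {t | LbarRel L lam t}

theorem lbarSub_graded : IsGraded (lbarSub L lam).toAddSubgroup := by
  apply isGraded_span
  intro t ht
  apply Submodule.subset_span
  have hcoe : ∀ k : queerWeightSpace L lam,
      ((parity (queerWeightSpace L lam) k : queerWeightSpace L lam) : L) = parity L k := by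
    intro k
    exact (parity_map (f := (queerWeightSpace L lam).subtype) (fun i x hx => hx) k).symm
  obtain ⟨x, hx, k, k', hk⟩ | ⟨x, hx, k⟩ | ⟨h, k⟩ | ⟨i, j, hij, m, hm, k⟩ := ht
  · rw [map_sub, parity_tmul, parity_tmul, Env.parityHom_ι, map_one]
    refine LbarRel.cartan _ (parity_mem_cartan hx) _ _ ?_
    rw [hcoe, hcoe, ← hk, parity_ι_smul]
  · rw [parity_tmul, Env.parityHom_ι]
    exact LbarRel.nPlus _ (parity_mem_nPlus hx) _
  · rw [map_sub, map_smul, parity_tmul, parity_tmul, Env.parityHom_ι, parity_cartanEven, map_one]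
    exact LbarRel.weight h _
  · rw [parity_tmul, map_pow, Env.parityHom_ι, parity_evenE]
    exact LbarRel.lower i j hij m hm _

/-- The `q(n)`-supermodule `L̄(λ)`. -/
abbrev Lbar : Type u := FreeMod (Queer n) (queerWeightSpace L lam) ⧸ lbarSub L lam

instance : SuperSpace (Lbar L lam) := quotientSuperSpace _ (lbarSub_graded L lam)

instance : IsSuperModule (Queer n) (Lbar L lam) := quotient_isSuperModule _ (lbarSub_graded L lam)

/-- The vector `k_λ ∈ L̄(λ)` given by `k ∈ L(λ)_λ`. -/
def lbarGen : queerWeightSpace L lam →ₗ[ℂ] Lbar L lam :=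
  (lbarSub L lam).mkQ.restrictScalars ℂ ∘ₗ TensorProduct.mk ℂ (Env (Queer n)) _ 1

end HighestWeight

/-! ### The induced module `P_A(V)` -/

section Induced

variable {n : ℕ} (A : Type v) [CommRing A] [Algebra ℂ A]

variable (n) in
/-- The homomorphism `U(q(n)) → U(q(n) ⊗ A)`. -/
def envIncl : Env (Queer n) →ₐ[ℂ] Env (Current n A) :=
  Env.map (incl n A) (incl_even A) (incl_bracket A)

theorem envIncl_ι (x : Queer n) : envIncl n A (Env.ι x) = Env.ι (incl n A x) := by
  rw [envIncl, Env.map_ι]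

theorem parityHom_envIncl (s : Env (Queer n)) :
    Env.parityHom (envIncl n A s) = envIncl n A (Env.parityHom s) := by
  have h : (Env.parityHom).comp (envIncl n A) = (envIncl n A).comp Env.parityHom := by
    apply Env.algHom_ext
    intro x
    simp only [AlgHom.comp_apply, Env.parityHom_ι, envIncl_ι]
    rw [parity_map (incl_even A)]
  exact DFunLike.congr_fun h s

variable (V : Type u) [AddCommGroup V] [Module ℂ V] [Module (Env (Queer n)) V]
  [IsScalarTower ℂ (Env (Queer n)) V] [SuperSpace V] [IsSuperModule (Queer n) V]

variable (n) in
/-- The relations `u s ⊗ v = u ⊗ s v`, `s ∈ U(q(n))`, that turn `U(q(n) ⊗ A) ⊗_ℂ V` into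
`U(q(n) ⊗ A) ⊗_{U(q(n))} V`. -/
def inducedSub : Submodule (Env (Current n A)) (FreeMod (Current n A) V) :=
  Submodule.span (Env (Current n A))
    {t | ∃ (u : Env (Current n A)) (s : Env (Queer n)) (v : V),
      t = (u * envIncl n A s) ⊗ₜ v - u ⊗ₜ (s • v)}

variable (n) in
theorem inducedSub_graded : IsGraded (inducedSub n A V).toAddSubgroup := by
  apply isGraded_span
  rintro _ ⟨u, s, v, rfl⟩
  apply Submodule.subset_span
  refine ⟨Env.parityHom u, Env.parityHom s, parity V v, ?_⟩
  rw [map_sub, parity_tmul, parity_tmul, map_mul, parityHom_envIncl, parity_smul]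

variable (n) in
/-- The `q(n) ⊗ A`-supermodule `P_A(V) = U(q(n) ⊗ A) ⊗_{U(q(n))} V`. -/
abbrev Induced : Type (max u v) := FreeMod (Current n A) V ⧸ inducedSub n A V

instance : SuperSpace (Induced n A V) := quotientSuperSpace _ (inducedSub_graded n A V)

instance : IsSuperModule (Current n A) (Induced n A V) :=
  quotient_isSuperModule _ (inducedSub_graded n A V)

variable (n) in
/-- The map `V → P_A(V)`, `v ↦ 1 ⊗ v`. -/
def inducedGen : V →ₗ[ℂ] Induced n A V :=
  (inducedSub n A V).mkQ.restrictScalars ℂ ∘ₗ TensorProduct.mk ℂ (Env (Current n A)) V 1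

end Induced

/-! ### The truncation `M^ν` -/

section Truncation

variable {n : ℕ} (A : Type v) [CommRing A] [Algebra ℂ A] (M : Type u) [AddCommGroup M]
  [Module ℂ M] [Module (Env (Current n A)) M] [IsScalarTower ℂ (Env (Current n A)) M]
  [SuperSpace M] [IsSuperModule (Current n A) M] (ν : Module.Dual ℂ (cartanEven n))

/-- The submodule `∑_{μ ∉ ν - Q⁺} U(q(n) ⊗ A) M_μ`. -/
def truncSub : Submodule (Env (Current n A)) M :=
  Submodule.span (Env (Current n A))
    {m | ∃ μ : Module.Dual ℂ (cartanEven n), ν - μ ∉ rootMonoid n ∧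
      m ∈ weightSpace A M μ}

theorem truncSub_graded : IsGraded (truncSub A M ν).toAddSubgroup := by
  apply isGraded_span
  rintro m ⟨μ, hμ, hm⟩
  exact Submodule.subset_span ⟨μ, hμ, parity_mem_weightSpace (incl_even A) hm⟩

/-- The quotient `M^ν` of `M`. -/
abbrev Truncation : Type u := M ⧸ truncSub A M ν

instance : SuperSpace (Truncation A M ν) := quotientSuperSpace _ (truncSub_graded A M ν)

instance : IsSuperModule (Current n A) (Truncation A M ν) :=
  quotient_isSuperModule _ (truncSub_graded A M ν)

end Truncation

/-! ### Global Weyl modules -/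

section Weyl

variable {n : ℕ} (A : Type v) [CommRing A] [Algebra ℂ A]

/-- The global Weyl module `W_A(λ) = P_A(L̄(λ))^λ`, for a given choice of `L(λ)`. -/
abbrev GlobalWeyl (L : Type u) [AddCommGroup L] [Module ℂ L] [Module (Env (Queer n)) L]
    [IsScalarTower ℂ (Env (Queer n)) L] [SuperSpace L] [IsSuperModule (Queer n) L]
    (lam : Module.Dual ℂ (cartanEven n)) : Type (max u v) :=
  Truncation A (Induced n A (Lbar L lam)) lam

/-- The map `k_λ ↦ w_λ` from `L(λ)_λ` to `W_A(λ)`. -/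
def weylGen (L : Type u) [AddCommGroup L] [Module ℂ L] [Module (Env (Queer n)) L]
    [IsScalarTower ℂ (Env (Queer n)) L] [SuperSpace L] [IsSuperModule (Queer n) L]
    (lam : Module.Dual ℂ (cartanEven n)) :
    queerWeightSpace L lam →ₗ[ℂ] GlobalWeyl A L lam :=
  (truncSub A (Induced n A (Lbar L lam)) lam).mkQ.restrictScalars ℂ ∘ₗ
    inducedGen n A (Lbar L lam) ∘ₗ lbarGen L lam

/-- The relations `(n⁺ ⊗ A) w = 0`, `h w = λ(h) w` for `h ∈ h₀`, and `f_i^{λ(h_i)+1} w = 0` for an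
element `w` of a `q(n) ⊗ A`-module. -/
structure WeylRel (lam : Module.Dual ℂ (cartanEven n)) {M : Type u} [AddCommGroup M] [Module ℂ M]
    [Module (Env (Current n A)) M] (w : M) : Prop where
  nPlus : ∀ x ∈ nPlus n, ∀ a : A, (Env.ι (x ⊗ₜ a) : Env (Current n A)) • w = 0
  weight : ∀ h : cartanEven n,
    (Env.ι ((h : Queer n) ⊗ₜ 1) : Env (Current n A)) • w = lam h • w
  lower : ∀ i j : Fin n, (j : ℕ) = i + 1 → ∀ m : ℕ, lam (kEven i) - lam (kEven j) = m →
    (Env.ι (evenE j i ⊗ₜ 1) : Env (Current n A)) ^ (m + 1) • w = 0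

/-- The `q(n) ⊗ A`-supermodule `W` is generated by the image of the even map `j : V → W`, with the
defining relations `y j(v) = j(v')` for `act y v v'`, together with `WeylRel` for all `j(v)`: these
relations hold in `W`, and `W` is universal among the supermodules in which they hold. -/
structure IsWeylPresentation (lam : Module.Dual ℂ (cartanEven n))
    {V : Type u} [AddCommGroup V] [Module ℂ V] [SuperSpace V]
    (act : Current n A → V → V → Prop)
    {W : Type (max u v)} [AddCommGroup W] [Module ℂ W] [Module (Env (Current n A)) W]
    [SuperSpace W] (j : V →ₗ[ℂ] W) : Prop where
  even : IsEvenMap j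
  span_eq_top : Submodule.span (Env (Current n A)) (Set.range j) = ⊤
  smul_eq : ∀ y v v', act y v v' → (Env.ι y : Env (Current n A)) • j v = j v'
  rel : ∀ v, WeylRel A lam (j v)
  existsUnique : ∀ (M : Type w) [AddCommGroup M] [Module ℂ M] [Module (Env (Current n A)) M]
    [IsScalarTower ℂ (Env (Current n A)) M] [SuperSpace M]
    [IsSuperModule (Current n A) M] (φ : V →ₗ[ℂ] M), IsEvenMap φ →
    (∀ y v v', act y v v' → (Env.ι y : Env (Current n A)) • φ v = φ v') →
    (∀ v, WeylRel A lam (φ v)) →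
    ∃! Φ : W →ₗ[Env (Current n A)] M, IsEvenMap Φ ∧ ∀ v, Φ (j v) = φ v

variable (n) in
/-- The subalgebra `h ⊗ A` of `q(n) ⊗ A`. -/
def cartanCurrent : Submodule ℂ (Current n A) :=
  LinearMap.range ((cartan n).subtype.rTensor A)

end Weyl

end QueerWeyl

end

open QueerWeyl QueerWeyl.Queer

namespace QueerWeyl

open SuperSpace LieSuperalgebra Queer

/-! ### Modules over enveloping superalgebras -/

section General

variable {g : Type u} [AddCommGroup g] [Module ℂ g] [LieSuperalgebra g]

/-! Consider any $\mathfrak q\otimes A$-module generated by vectors of weight $\lambda$ that satisfy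
$(*)$. As $\mathfrak n^+\otimes A$ kills the generators, the whole module is obtained from them by
applying $\mathfrak h\otimes A$ and $\mathfrak n^-\otimes A$ (`span_subset_of_stable`). Hence all
weights lie in $\lambda-Q^+$ (`span_subset_weightSum`), and since $Q^+$ is pointed, weight $\lambda$
is reached from the generators through $\mathfrak h\otimes A$ alone
(`weightSpace_subset_of_stable`).

The presentation by $L(\lambda)_\lambda$ composes three universal properties. A map $\varphi$
satisfying $(*)$ extends to $\bar L(\lambda)$ by the defining relations, then to $P$ by Frobenius
reciprocity. It then factors through the truncation, because the image has weights only in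
$\lambda-Q^+$ and so every $P_\mu$ with $\mu\notin\lambda-Q^+$ maps to zero
(`exists_truncation_lift`). Conversely, $(*)$ holds for the $w_k$: the relations for $\mathfrak
h_{\bar0}$ and $f_i$ come from $\bar L(\lambda)$, and $\mathfrak n^+\otimes A$ sends weight
$\lambda$ outside $\lambda-Q^+$, where the truncation is zero (`weylRel_mkQ_truncSub`).

For the whole weight space (`weylRel_of_mem_weightSpace`), $\mathfrak n^+\otimes A$ again kills it
for reasons of weight. As $\operatorname{ad} f_i$ is nilpotent and $f_i$ acts nilpotently on the
generators, it acts locally nilpotently everywhere (`exists_pow_smul_eq_zero`); an $\mathfrak{sl}_2$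
computation sharpens the exponent to $\lambda(h_i)+1$ (`pow_smul_eq_zero_of_sl2`). A map $\varphi$
on $W_A(\lambda)_\lambda$ is restricted to the $w_k$ and extended to $\Phi$; then $\Phi$ and
$\varphi$ agree on the $w_k$, both are compatible with $\mathfrak h\otimes A$, and so they agree on
the whole weight space (`eqOn_weightSpace`).

Lifts are built without gradings; they are even because they commute with the parity involutions on
generators (`isEvenMap_of_span`). -/

theorem Env.adjoin_range_ι : Algebra.adjoin ℂ (Set.range (Env.ι : g → Env g)) = ⊤ := by
  rw [eq_top_iff]
  intro a _
  have hf : ∀ x : g, (Env.ι x : Env g) ∈ Algebra.adjoin ℂ (Set.range (Env.ι : g → Env g)) :=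
    fun x => Algebra.subset_adjoin ⟨x, rfl⟩
  let j : g →ₗ[ℂ] Algebra.adjoin ℂ (Set.range (Env.ι : g → Env g)) :=
    { toFun := fun x => ⟨Env.ι x, hf x⟩
      map_add' := fun x y => Subtype.ext (map_add _ x y)
      map_smul' := fun c x => Subtype.ext (map_smul _ c x) }
  -- By the universal property, $\iota$ corestricted to the subalgebra extends to $U(g)$. Followed
  -- by the inclusion it is the identity on generators, hence everywhere, so every element lies in
  -- the subalgebra.
  let f : Env g →ₐ[ℂ] Algebra.adjoin ℂ (Set.range (Env.ι : g → Env g)) :=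
    Env.lift j (fun hx hy => Subtype.ext (Env.ι_mul_ι hx hy))
  have h : (Subalgebra.val _).comp f = AlgHom.id ℂ (Env g) :=
    Env.algHom_ext fun x => by
      rw [AlgHom.comp_apply, Env.lift_ι]; rfl
  have h' := DFunLike.congr_fun h a
  rw [AlgHom.id_apply] at h'
  rw [← h']
  exact (f a).2

theorem superSign_zero_left (j : ZMod 2) : superSign 0 j = 1 := by simp [superSign]

/-- An even element satisfies `y x = [y, x] + x y` for all `x`. -/
theorem Env.even_mul {y : g} (hy : y ∈ (gr 0 : Submodule ℂ g)) (x : g) :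
    (Env.ι y * Env.ι x : Env g) = Env.ι (bracket y x) + Env.ι x * Env.ι y := by
  induction x using homogeneous_induction with
  | h i x hx => rw [Env.ι_mul_ι hy hx, superSign_zero_left, one_smul]
  | hadd a b ha hb =>
    rw [map_add, mul_add, ha, hb, map_add, map_add, add_mul]; abel

/-- Vectors on which an even ad-nilpotent element acts nilpotently are stable under `g`. -/
theorem exists_pow_smul_eq_zero {M : Type v} [AddCommGroup M] [Module (Env g) M] {y : g}
    (hy : y ∈ (gr 0 : Submodule ℂ g)) (d : ℕ) :
    ∀ (x : g), ((bracket y : g →ₗ[ℂ] g) ^ d) x = 0 → ∀ (k : ℕ) (m : M),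
      (Env.ι y : Env g) ^ k • m = 0 → ∃ K, (Env.ι y : Env g) ^ K • (Env.ι x : Env g) • m = 0 := by
  have hpow : ∀ {K K' : ℕ} {m : M}, K ≤ K' → (Env.ι y : Env g) ^ K • m = 0 →
      (Env.ι y : Env g) ^ K' • m = 0 := by
    intro K K' m hK h
    obtain ⟨r, rfl⟩ := Nat.exists_eq_add_of_le' hK
    rw [pow_add, mul_smul, h, smul_zero]
  -- Double induction, from $y^{K+1}xm=y^K[y,x]m+y^Kx(ym)$: the first term lowers the ad-nilpotency
  -- order $d$ of $x$, the second lowers the exponent $k$ that kills $m$.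
  induction d with
  | zero => intro x hx k m _; exact ⟨0, by simp at hx; simp [hx]⟩
  | succ d ihd =>
    intro x hx k
    induction k with
    | zero => intro m hm; exact ⟨0, by simp at hm; simp [hm]⟩
    | succ k ihk =>
      intro m hm
      obtain ⟨K, hK⟩ := ihd (bracket y x) (by simpa [pow_succ] using hx) (k + 1) m hm
      obtain ⟨K', hK'⟩ := ihk ((Env.ι y : Env g) • m) (by rw [← mul_smul, ← pow_succ]; exact hm)
      refine ⟨max K K' + 1, ?_⟩
      rw [pow_succ, mul_smul, ← mul_smul _ _ m, Env.even_mul hy, add_smul, smul_add,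
        hpow (le_max_left K K') hK, mul_smul, hpow (le_max_right K K') hK', add_zero]

variable {M : Type v} [AddCommGroup M] [Module ℂ M] [Module (Env g) M]
  [IsScalarTower ℂ (Env g) M]

theorem env_smul_mem {N : Submodule ℂ M} (hN : ∀ (x : g), ∀ m ∈ N, (Env.ι x : Env g) • m ∈ N)
    (a : Env g) {m : M} (hm : m ∈ N) : a • m ∈ N := by
  have ha : a ∈ Algebra.adjoin ℂ (Set.range (Env.ι : g → Env g)) := by
    rw [Env.adjoin_range_ι]; trivial
  induction ha using Algebra.adjoin_induction generalizing m with
  | mem x hx => obtain ⟨y, rfl⟩ := hx; exact hN y m hm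
  | algebraMap r => rw [algebraMap_smul]; exact N.smul_mem r hm
  | add x y _ _ hx hy => rw [add_smul]; exact N.add_mem (hx hm) (hy hm)
  | mul x y _ _ hx hy => rw [mul_smul]; exact hx (hy hm)

theorem span_subset_of_ι_smul_mem {X : Set M} {N : Submodule ℂ M} (hX : X ⊆ N)
    (hN : ∀ (x : g), ∀ m ∈ N, (Env.ι x : Env g) • m ∈ N) {m : M}
    (hm : m ∈ Submodule.span (Env g) X) : m ∈ N := by
  induction hm using Submodule.span_induction with
  | mem x hx => exact hX hx
  | zero => exact zero_mem _
  | add x y _ _ hx hy => exact add_mem hx hy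
  | smul a x _ hx => exact env_smul_mem hN a hx

/-- The smallest subspace containing `X` and stable under the elements of `B`. -/
inductive StableClosure (B : Set g) (X : Set M) : M → Prop
  | mem {m : M} (hm : m ∈ X) : StableClosure B X m
  | zero : StableClosure B X 0
  | add {m m' : M} (hm : StableClosure B X m) (hm' : StableClosure B X m') :
      StableClosure B X (m + m')
  | smul (c : ℂ) {m : M} (hm : StableClosure B X m) : StableClosure B X (c • m)
  | act {y : g} (hy : y ∈ B) {m : M} (hm : StableClosure B X m) :
      StableClosure B X ((Env.ι y : Env g) • m)

/-- If `g` is spanned by homogeneous elements `B` and by elements `P` that kill `X`, then the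
submodule generated by `X` is obtained by applying elements of `B` repeatedly. -/
theorem StableClosure.ι_smul {B P : Set g} (hB : ∀ y ∈ B, ∃ i, y ∈ (gr i : Submodule ℂ g))
    (hBP : Submodule.span ℂ (B ∪ P) = ⊤) {X : Set M}
    (hP : ∀ y ∈ P, ∀ m ∈ X, (Env.ι y : Env g) • m = 0) {m : M} (hm : StableClosure B X m)
    (x : g) : StableClosure B X ((Env.ι x : Env g) • m) := by
  induction hm generalizing x with
  | mem hm =>
    have hx : x ∈ Submodule.span ℂ (B ∪ P) := by rw [hBP]; trivial
    induction hx using Submodule.span_induction with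
    | mem y hy =>
      rcases hy with hy | hy
      · exact .act hy (.mem hm)
      · rw [hP y hy _ hm]; exact .zero
    | zero => rw [map_zero, zero_smul]; exact .zero
    | add a b _ _ ha hb => rw [map_add, add_smul]; exact .add ha hb
    | smul c a _ ha => rw [map_smul, smul_assoc]; exact .smul c ha
  | zero => rw [smul_zero]; exact .zero
  | add _ _ h h' => rw [smul_add]; exact .add (h x) (h' x)
  | smul c _ h => rw [smul_comm]; exact .smul c (h x)
  -- Here $xym=[x,y]m\pm y(xm)$, and the induction hypothesis holds for all elements of $g$, so it
  -- covers both $[x,y]m$ and $xm$. No ordering of monomials is needed.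
  | act hy _ h =>
    obtain ⟨j, hj⟩ := hB _ hy
    induction x using homogeneous_induction with
    | h i x hx =>
      rw [← mul_smul, Env.ι_mul_ι hx hj, add_smul, smul_assoc, mul_smul]
      exact .add (h _) (.smul _ (.act hy (h x)))
    | hadd a b ha hb => rw [map_add, add_smul]; exact .add ha hb

/-- This replaces the factorization $U(g)=U(\mathfrak h\oplus\mathfrak n^-)U(\mathfrak n^+)$ given
by the PBW theorem: when `P` kills the generators, stability has to be checked for `B` only. -/
theorem span_subset_of_stable {B P : Set g} (hB : ∀ y ∈ B, ∃ i, y ∈ (gr i : Submodule ℂ g))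
    (hBP : Submodule.span ℂ (B ∪ P) = ⊤) {X : Set M}
    (hP : ∀ y ∈ P, ∀ m ∈ X, (Env.ι y : Env g) • m = 0) {N : Submodule ℂ M} (hX : X ⊆ N)
    (hN : ∀ y ∈ B, ∀ m ∈ N, (Env.ι y : Env g) • m ∈ N) {m : M}
    (hm : m ∈ Submodule.span (Env g) X) : m ∈ N := by
  let S : Submodule ℂ M :=
    { carrier := {m | StableClosure B X m}
      zero_mem' := .zero
      add_mem' := .add
      smul_mem' := fun c _ h => .smul c h }
  have h : ∀ m, StableClosure B X m → m ∈ N := by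
    intro m h
    induction h with
    | mem hm => exact hX hm
    | zero => exact zero_mem _
    | add _ _ h h' => exact add_mem h h'
    | smul c _ h => exact N.smul_mem c h
    | act hy _ h => exact hN _ hy _ h
  exact h m (span_subset_of_ι_smul_mem (N := S) (fun _ => .mem)
    (fun x _ hm => StableClosure.ι_smul hB hBP hP hm x) hm)

/-- A linear map that commutes with the parity involutions on a generating set is even. -/
theorem isEvenMap_of_span {M' : Type w} [AddCommGroup M'] [Module ℂ M'] [Module (Env g) M']
    [IsScalarTower ℂ (Env g) M'] [SuperSpace M] [SuperSpace M'] [IsSuperModule g M]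
    [IsSuperModule g M'] (f : M →ₗ[Env g] M') {X : Set M}
    (hX : Submodule.span (Env g) X = ⊤)
    (h : ∀ x ∈ X, parity M' (f x) = f (parity M x)) : IsEvenMap f := by
  intro i m hm
  have key : ∀ m, parity M' (f m) = f (parity M m) := by
    intro m
    have hm : m ∈ Submodule.span (Env g) X := by rw [hX]; trivial
    induction hm using Submodule.span_induction with
    | mem x hx => exact h x hx
    | zero => simp
    | add x y _ _ hx hy => simp [hx, hy]
    | smul a x _ hx => rw [map_smul, parity_smul, parity_smul, map_smul, hx]
  rw [mem_gr_iff] at hm ⊢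
  rw [key, hm, ← algebraMap_smul (Env g) (paritySign i) m, map_smul, algebraMap_smul]

/-- The usual formulas for a primitive vector, by induction on `k` from $[e,f]=h$ and $[h,f]=-2f$.
The relation $[h,e]=2e$ does not enter. -/
theorem smul_pow_of_sl2 {e f h : Env g} (hef : e * f = h + f * e)
    (hhf : h * f = f * h - (2 : ℂ) • f) {c : ℂ} {w : M} (he : e • w = 0) (hh : h • w = c • w) :
    ∀ k : ℕ, h • f ^ k • w = (c - 2 * k) • f ^ k • w ∧
      e • f ^ (k + 1) • w = ((k + 1) * (c - k)) • f ^ k • w := by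
  have hs : ∀ k : ℕ, f ^ (k + 1) • w = f • f ^ k • w := fun k => by rw [pow_succ', mul_smul]
  have hweight : ∀ k : ℕ, h • f ^ k • w = (c - 2 * k) • f ^ k • w := by
    intro k
    induction k with
    | zero => simp [hh]
    | succ k ih =>
      rw [hs, ← mul_smul h f, hhf, sub_smul, mul_smul, ih, smul_comm, smul_assoc, ← sub_smul]
      push_cast
      congr 1; ring
  refine fun k => ⟨hweight k, ?_⟩
  induction k with
  | zero =>
    simp only [zero_add, pow_one, pow_zero, one_smul]
    rw [← mul_smul, hef, add_smul, mul_smul, he, hh]; simp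
  | succ k ih =>
    rw [hs (k + 1), ← mul_smul e f, hef, add_smul, hweight, mul_smul, ih, smul_comm f, ← hs,
      ← add_smul]
    push_cast
    congr 1; ring

/-- A primitive vector of weight `m ∈ ℕ` on which `f` acts nilpotently is killed by `f ^ (m + 1)`. -/
theorem pow_smul_eq_zero_of_sl2 {e f h : Env g} (hef : e * f = h + f * e)
    (hhf : h * f = f * h - (2 : ℂ) • f) {m : ℕ} {w : M} (he : e • w = 0)
    (hh : h • w = (m : ℂ) • w) {N : ℕ} (hN : f ^ N • w = 0) : f ^ (m + 1) • w = 0 := by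
  induction N with
  | zero => rw [pow_zero, one_smul] at hN; rw [hN, smul_zero]
  | succ N ih =>
    -- From $f^{N+1}w=0$ one gets $(N+1)(m-N)f^Nw=0$. So the exponent can be lowered except when
    -- $N=m$, where $f^{N+1}w=0$ is already the claim.
    have h1 := (smul_pow_of_sl2 hef hhf he hh N).2
    rw [hN, smul_zero] at h1
    rcases smul_eq_zero.1 h1.symm with h2 | h2
    · rcases mul_eq_zero.1 h2 with h3 | h3
      · exact absurd h3 (by exact_mod_cast N.succ_ne_zero)
      · have : m = N := by exact_mod_cast sub_eq_zero.1 h3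
        rwa [this]
    · exact ih h2

/-- The linear map `U(g) ⊗ V → M`, `a ⊗ v ↦ a φ(v)`. -/
theorem exists_freeMod_lift {V : Type w} [AddCommGroup V] [Module ℂ V] (φ : V →ₗ[ℂ] M) :
    ∃ F : FreeMod g V →ₗ[Env g] M, ∀ a v, F (a ⊗ₜ v) = a • φ v := by
  let F : FreeMod g V →ₗ[ℂ] M :=
    TensorProduct.lift ((Algebra.lsmul ℂ ℂ M).toLinearMap.flip ∘ₗ φ).flip
  have hF : ∀ a v, F (a ⊗ₜ v) = a • φ v := fun a v => rfl
  refine ⟨{ toFun := F, map_add' := map_add F, map_smul' := ?_ }, hF⟩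
  intro a x
  induction x using TensorProduct.induction_on with
  | zero => simp
  | tmul b v => rw [TensorProduct.smul_tmul', hF, smul_eq_mul, mul_smul, hF]; rfl
  | add x y hx hy => rw [smul_add, map_add, hx, hy, map_add, smul_add]

end General

/-! ### Matrix units and roots of `q(n)` -/

namespace Queer

variable {n : ℕ}

/-- The matrix unit of parity `s` of `q(n)`. -/
def unitE (s : ZMod 2) (i j : Fin n) : Queer n := if s = 0 then evenE i j else oddE i j

theorem unitE_mem (s : ZMod 2) (i j : Fin n) : unitE s i j ∈ (gr s : Submodule ℂ (Queer n)) := by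
  rcases zmod_cases s with rfl | rfl <;> simp [unitE, gr, evenE, oddE]

/-- `y` is a root vector for `α`, or an element of the Cartan subalgebra if `α = 0`. -/
def IsRootVector (α : Module.Dual ℂ (cartanEven n)) (y : Queer n) : Prop :=
  ∀ h : cartanEven n, bracket (h : Queer n) y = α h • y

theorem oddBlock_cartanEven (h : cartanEven n) : oddBlock (h : Queer n) = 0 := by
  have := h.2.2
  simpa [gr] using this

theorem evenBlock_cartanEven (h : cartanEven n) :
    evenBlock (h : Queer n) = Matrix.diagonal fun i => evenBlock (h : Queer n) i i :=
  (h.2.1.1.diagonal_diag).symm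

/-- An element of $\mathfrak h_{\bar0}$ has zero odd block, so it acts on both blocks by the
commutator with the same diagonal matrix, and the two parities have the same roots. The case `i = j`
is included, with root zero. -/
theorem isRootVector_unitE (s : ZMod 2) (i j : Fin n) :
    IsRootVector (epsilon i - epsilon j) (unitE s i j) := by
  intro h
  have h0 := oddBlock_cartanEven h
  have h1 := evenBlock_cartanEven h
  change superBracket (h : Queer n) (unitE s i j) =
    (evenBlock (h : Queer n) i i - evenBlock (h : Queer n) j j) • unitE s i j
  have key : evenBlock (h : Queer n) * Matrix.single i j 1 -
      Matrix.single i j 1 * evenBlock (h : Queer n) =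
      (evenBlock (h : Queer n) i i - evenBlock (h : Queer n) j j) • Matrix.single i j (1 : ℂ) := by
    rw [h1]
    ext a b
    simp only [Matrix.sub_apply, Matrix.diagonal_mul, Matrix.mul_diagonal, Matrix.smul_apply,
      Matrix.single_apply, Matrix.diagonal_apply_eq, smul_eq_mul]
    split_ifs with hab
    · rw [hab.1, hab.2]; ring
    · simp
  rcases zmod_cases s with rfl | rfl
  · exact ext_blocks (by simpa [unitE, evenE, h0] using key) (by simp [unitE, evenE, h0])
  · exact ext_blocks (by simp [unitE, oddE, h0]) (by simpa [unitE, oddE, h0] using key)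

/-- Only commutators of diagonal matrices survive, since the odd block of an element of $\mathfrak
h_{\bar0}$ vanishes. Thus $\mathfrak h_{\bar0}$ commutes with $\mathfrak h_{\bar1}$ too. -/
theorem isRootVector_of_mem_cartan {x : Queer n} (hx : x ∈ cartan n) : IsRootVector 0 x := by
  intro h
  have h0 := oddBlock_cartanEven h
  have h1 := evenBlock_cartanEven h
  obtain ⟨hx0, hx1⟩ := hx
  change superBracket (h : Queer n) x = (0 : ℂ) • x
  have h2 := hx0.diagonal_diag
  have h3 := hx1.diagonal_diag
  apply ext_blocks
  · rw [evenBlock_superBracket, h0, h1, ← h2]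
    simp [Matrix.diagonal_mul_diagonal, mul_comm]
  · rw [oddBlock_superBracket, h0, h1, ← h3]
    simp [Matrix.diagonal_mul_diagonal, mul_comm]

theorem eq_sum_unitE (x : Queer n) : x = ∑ i, ∑ j,
    (evenBlock x i j • unitE 0 i j + oddBlock x i j • unitE 1 i j) := by
  apply ext_blocks
  · simp only [map_sum, map_add, map_smul]
    simp only [unitE, if_true, one_ne_zero, if_false, evenE, oddE, evenBlock_mk, smul_zero,
      add_zero, Matrix.smul_single, smul_eq_mul, mul_one]
    exact Matrix.matrix_eq_sum_single _
  · simp only [map_sum, map_add, map_smul]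
    simp only [unitE, if_true, one_ne_zero, if_false, evenE, oddE, oddBlock_mk, smul_zero,
      zero_add, Matrix.smul_single, smul_eq_mul, mul_one]
    exact Matrix.matrix_eq_sum_single _

/-- An element of `h₀` whose value on each simple root is `1`. -/
def heightElt (n : ℕ) : cartanEven n := ∑ i : Fin n, (-(i : ℂ)) • kEven i

theorem epsilon_kEven (i j : Fin n) : epsilon i (kEven j) = if j = i then 1 else 0 := by
  simp [epsilon, kEven, evenE, Matrix.single_apply]

theorem epsilon_heightElt (i : Fin n) : epsilon i (heightElt n) = -(i : ℂ) := by
  simp [heightElt, epsilon_kEven]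

/-- The height takes natural values on $Q^+$; this is the source of pointedness. -/
theorem exists_nat_of_mem_rootMonoid {β : Module.Dual ℂ (cartanEven n)} (h : β ∈ rootMonoid n) :
    ∃ N : ℕ, β (heightElt n) = N := by
  induction h using AddSubmonoid.closure_induction with
  | mem x hx =>
    obtain ⟨i, j, hij, rfl⟩ := hx
    exact ⟨1, by rw [LinearMap.sub_apply, epsilon_heightElt, epsilon_heightElt, hij]; simp⟩
  | zero => exact ⟨0, by simp⟩
  | add x y _ _ hx hy =>
    obtain ⟨a, ha⟩ := hx
    obtain ⟨b, hb⟩ := hy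
    exact ⟨a + b, by rw [LinearMap.add_apply, ha, hb, Nat.cast_add]⟩

/-- Pointedness of $Q^+$ in the form in which it is used: the height of the sum is at least $j-i>0$.
-/
theorem add_ne_zero_of_lt {β : Module.Dual ℂ (cartanEven n)} (h : β ∈ rootMonoid n)
    {i j : Fin n} (hij : i < j) : β + (epsilon i - epsilon j) ≠ 0 := by
  obtain ⟨N, hN⟩ := exists_nat_of_mem_rootMonoid h
  intro h0
  have h1 := LinearMap.congr_fun h0 (heightElt n)
  rw [LinearMap.add_apply, LinearMap.sub_apply, epsilon_heightElt, epsilon_heightElt, hN,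
    LinearMap.zero_apply] at h1
  have h2 : ((N + j : ℕ) : ℂ) = (i : ℕ) := by push_cast; linear_combination h1
  have h3 : N + (j : ℕ) = i := by exact_mod_cast h2
  omega

/-- Telescoping into simple roots; the empty sum covers `i = j`. -/
theorem root_mem_rootMonoid {i j : Fin n} (hij : i ≤ j) : epsilon i - epsilon j ∈ rootMonoid n := by
  obtain ⟨d, hd⟩ := Nat.exists_eq_add_of_le (Fin.le_def.1 hij)
  induction d generalizing j with
  | zero =>
    have : j = i := Fin.ext (by simpa using hd)
    rw [this, sub_self]; exact zero_mem _
  | succ d ih =>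
    let k : Fin n := ⟨i + d, by omega⟩
    rw [← sub_add_sub_cancel _ (epsilon k)]
    exact add_mem (ih (j := k) (Fin.le_def.2 (by simp [k])) rfl)
      (AddSubmonoid.subset_closure ⟨k, j, by simp only [k]; omega, rfl⟩)

end Queer

/-! ### Weights of `q(n) ⊗ A`-modules -/

section Weights

variable {n : ℕ} {A : Type v} [CommRing A] [Algebra ℂ A]

theorem currentAlgebra_bracket_tmul (x y : Queer n) (a b : A) :
    (currentAlgebra (Queer n) A).bracket (x ⊗ₜ a) (y ⊗ₜ b) = bracket x y ⊗ₜ (a * b) := rfl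

theorem tmul_mem_gr {i : ZMod 2} {x : Queer n} (hx : x ∈ (gr i : Submodule ℂ (Queer n))) (a : A) :
    x ⊗ₜ a ∈ (currentAlgebra (Queer n) A).gr i :=
  ⟨(⟨x, hx⟩ : (gr i : Submodule ℂ (Queer n))) ⊗ₜ a, rfl⟩

variable (n A) in
/-- The spanning set of `(h ⊕ n⁻) ⊗ A` given by matrix units. -/
def lowerSet : Set (Current n A) := {y | ∃ s i j a, j ≤ i ∧ y = unitE s i j ⊗ₜ a}

variable (n A) in
/-- The spanning set of `n⁺ ⊗ A` given by matrix units. -/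
def raiseSet : Set (Current n A) := {y | ∃ s i j a, i < j ∧ y = unitE s i j ⊗ₜ a}

theorem lowerSet_homogeneous : ∀ y ∈ lowerSet n A, ∃ i, y ∈ (currentAlgebra (Queer n) A).gr i := by
  rintro _ ⟨s, i, j, a, _, rfl⟩
  exact ⟨s, tmul_mem_gr (unitE_mem s i j) a⟩

theorem span_lowerSet_union_raiseSet : Submodule.span ℂ (lowerSet n A ∪ raiseSet n A) = ⊤ := by
  rw [eq_top_iff]
  intro y _
  have hmem : ∀ s i j a, unitE s i j ⊗ₜ a ∈ Submodule.span ℂ (lowerSet n A ∪ raiseSet n A) := by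
    intro s i j a
    apply Submodule.subset_span
    rcases lt_or_ge i j with h | h
    · exact .inr ⟨s, i, j, a, h, rfl⟩
    · exact .inl ⟨s, i, j, a, h, rfl⟩
  induction y using TensorProduct.induction_on with
  | zero => exact zero_mem _
  | add x y hx hy => exact add_mem (hx trivial) (hy trivial)
  | tmul x a =>
    rw [eq_sum_unitE x, TensorProduct.sum_tmul]
    refine sum_mem fun i _ => ?_
    rw [TensorProduct.sum_tmul]
    refine sum_mem fun j _ => ?_
    rw [TensorProduct.add_tmul, ← TensorProduct.smul_tmul', ← TensorProduct.smul_tmul']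
    exact add_mem (Submodule.smul_mem _ _ (hmem _ _ _ _)) (Submodule.smul_mem _ _ (hmem _ _ _ _))

theorem tmul_mem_span_raiseSet {x : Queer n} (hx : x ∈ nPlus n) (a : A) :
    x ⊗ₜ a ∈ Submodule.span ℂ (raiseSet n A) := by
  rw [eq_sum_unitE x, TensorProduct.sum_tmul]
  refine sum_mem fun i _ => ?_
  rw [TensorProduct.sum_tmul]
  refine sum_mem fun j _ => ?_
  rcases lt_or_ge i j with h | h
  · rw [TensorProduct.add_tmul, ← TensorProduct.smul_tmul', ← TensorProduct.smul_tmul']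
    exact add_mem (Submodule.smul_mem _ _ (Submodule.subset_span ⟨_, i, j, a, h, rfl⟩))
      (Submodule.smul_mem _ _ (Submodule.subset_span ⟨_, i, j, a, h, rfl⟩))
  · rw [(hx i j h).1, (hx i j h).2]; simp

theorem unitE_mem_nPlus (s : ZMod 2) {i j : Fin n} (hij : i < j) : unitE s i j ∈ nPlus n := by
  intro a b hab
  rcases zmod_cases s with rfl | rfl
  · simp only [unitE, if_true, evenE, evenBlock_mk, oddBlock_mk, Matrix.zero_apply, and_true]
    exact Matrix.single_apply_of_ne _ _ _ _ _ (by rintro ⟨rfl, rfl⟩; omega)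
  · simp only [unitE, one_ne_zero, if_false, oddE, evenBlock_mk, oddBlock_mk, Matrix.zero_apply,
      true_and]
    exact Matrix.single_apply_of_ne _ _ _ _ _ (by rintro ⟨rfl, rfl⟩; omega)

theorem unitE_mem_cartan (s : ZMod 2) (i : Fin n) : unitE s i i ∈ cartan n := by
  have h : (Matrix.single i i (1 : ℂ)).IsDiag := fun a b hab =>
    Matrix.single_apply_of_ne _ _ _ _ _ (by rintro ⟨rfl, rfl⟩; exact hab rfl)
  rcases zmod_cases s with rfl | rfl
  · exact ⟨by simpa [unitE, evenE] using h, by simp [unitE, evenE]⟩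
  · exact ⟨by simp [unitE, oddE], by simpa [unitE, oddE] using h⟩

variable {M : Type u} [AddCommGroup M] [Module ℂ M] [Module (Env (Current n A)) M]
  [IsScalarTower ℂ (Env (Current n A)) M]

/-- One has $hym=[h,y]m+yhm$, without sign even for odd $y$ because $h$ is even. The factor $a$ does
not change the weight, as $\mathfrak h_{\bar0}$ acts through $h\otimes1$. -/
theorem ι_smul_mem_weightSpace {α μ : Module.Dual ℂ (cartanEven n)} {y : Queer n}
    (hy : IsRootVector α y) (a : A) {m : M} (hm : m ∈ weightSpace A M μ) :
    (Env.ι (y ⊗ₜ a) : Env (Current n A)) • m ∈ weightSpace A M (μ + α) := by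
  intro h
  have hm' := hm h
  rw [incl_apply] at hm' ⊢
  rw [← mul_smul, Env.even_mul (tmul_mem_gr h.2.2 1), currentAlgebra_bracket_tmul, one_mul, hy h,
    ← TensorProduct.smul_tmul', map_smul, add_smul, mul_smul, hm', smul_assoc, smul_comm (Env.ι _),
    ← add_smul, add_comm]
  rfl

theorem ι_smul_mem_weightSpace_of_cartanCurrent {μ : Module.Dual ℂ (cartanEven n)}
    {y : Current n A} (hy : y ∈ cartanCurrent n A) {m : M} (hm : m ∈ weightSpace A M μ) :
    (Env.ι y : Env (Current n A)) • m ∈ weightSpace A M μ := by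
  obtain ⟨z, rfl⟩ := hy
  induction z using TensorProduct.induction_on with
  | zero => simp
  | add x y hx hy => rw [map_add, map_add, add_smul]; exact add_mem hx hy
  | tmul x a => simpa using ι_smul_mem_weightSpace (isRootVector_of_mem_cartan x.2) a hm

variable (A M) in
-- The elements of $\mathfrak h_{\bar0}$ act by commuting operators, whose joint generalized
-- eigenspaces are independent on any module, with no finiteness assumption. Weight spaces lie
-- inside these.
theorem iSupIndep_weightSpace : iSupIndep fun μ : Module.Dual ℂ (cartanEven n) => weightSpace A M μ := by
  let f : cartanEven n → Module.End ℂ M :=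
    fun h => Algebra.lsmul ℂ ℂ M (Env.ι (incl n A h) : Env (Current n A))
  have hcomm : ∀ h h', Commute (f h) (f h') := by
    intro h h'
    apply Commute.map
    change Env.ι (incl n A h) * Env.ι (incl n A h') = Env.ι (incl n A h') * Env.ι (incl n A h)
    rw [incl_apply, incl_apply, Env.even_mul (tmul_mem_gr h.2.2 1), currentAlgebra_bracket_tmul,
      isRootVector_of_mem_cartan h'.2.1 h]
    simp
  have key := Module.End.independent_iInf_maxGenEigenspace_of_forall_mapsTo f
    fun i j c => Module.End.mapsTo_maxGenEigenspace_of_comm (hcomm j i) c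
  -- The general result is indexed by all functions $\mathfrak h_{\bar0}\to\mathbb C$; weights form
  -- the subfamily of linear ones.
  refine (key.comp (f := fun μ : Module.Dual ℂ (cartanEven n) => (μ : cartanEven n → ℂ))
    DFunLike.coe_injective).mono fun μ m hm => ?_
  refine Submodule.mem_iInf _ |>.2 fun h => ?_
  exact Module.End.eigenspace_le_maxGenEigenspace (Module.End.mem_eigenspace_iff.2 (hm h))

variable (A M) in
/-- The sum of the weight spaces for a set of weights. -/
def weightSum (S : Set (Module.Dual ℂ (cartanEven n))) : Submodule ℂ M :=
  ⨆ μ ∈ S, weightSpace A M μ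

theorem mem_weightSum {S : Set (Module.Dual ℂ (cartanEven n))} {μ : Module.Dual ℂ (cartanEven n)}
    (hμ : μ ∈ S) {m : M} (hm : m ∈ weightSpace A M μ) : m ∈ weightSum A M S :=
  le_iSup₂ (f := fun (μ : Module.Dual ℂ (cartanEven n)) (_ : μ ∈ S) => weightSpace A M μ) μ hμ hm

/-- The vanishing test behind every argument by weights below. -/
theorem eq_zero_of_mem_weightSum {S : Set (Module.Dual ℂ (cartanEven n))}
    {μ : Module.Dual ℂ (cartanEven n)} (hμ : μ ∉ S) {m : M} (hm : m ∈ weightSpace A M μ)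
    (hmS : m ∈ weightSum A M S) : m = 0 :=
  Submodule.disjoint_def.1 ((iSupIndep_weightSpace A M).disjoint_biSup hμ) m hm hmS

theorem ι_smul_mem_weightSum {S S' : Set (Module.Dual ℂ (cartanEven n))}
    {α : Module.Dual ℂ (cartanEven n)} (hS : ∀ μ ∈ S, μ + α ∈ S') {y : Queer n}
    (hy : IsRootVector α y) (a : A) {m : M} (hm : m ∈ weightSum A M S) :
    (Env.ι (y ⊗ₜ a) : Env (Current n A)) • m ∈ weightSum A M S' := by
  let f : Module.End ℂ M := Algebra.lsmul ℂ ℂ M (Env.ι (y ⊗ₜ a) : Env (Current n A))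
  have h : weightSum A M S ≤ (weightSum A M S').comap f :=
    iSup₂_le fun μ hμ m hm => mem_weightSum (hS μ hμ) (ι_smul_mem_weightSpace hy a hm)
  exact h hm

end Weights

/-! ### The `sl₂`-triples of simple roots -/

namespace Queer

variable {n : ℕ}

theorem bracket_evenE_evenE (i j : Fin n) :
    bracket (evenE i j) (evenE j i) = ((kEven i - kEven j : cartanEven n) : Queer n) := by
  change superBracket (evenE i j) (evenE j i) = evenE i i - evenE j j
  exact ext_blocks (by simp [evenE]) (by simp [evenE])

/-- Let $E=E_{ij}$, so $E^2=0$. Every term of the threefold commutator with $E$ has at least two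
factors $E$ on the same side of the block, hence vanishes. -/
theorem bracket_evenE_pow_three {i j : Fin n} (hij : i ≠ j) (x : Queer n) :
    bracket (evenE i j) (bracket (evenE i j) (bracket (evenE i j) x)) = 0 := by
  change superBracket _ (superBracket _ (superBracket _ x)) = 0
  have hE : Matrix.single i j (1 : ℂ) * Matrix.single i j 1 = 0 :=
    Matrix.single_mul_single_of_ne _ _ _ _ hij.symm _
  have h0 : evenBlock (evenE i j) = Matrix.single i j (1 : ℂ) := rfl
  have h1 : oddBlock (evenE i j) = 0 := rfl
  generalize Matrix.single i j (1 : ℂ) = E at hE h0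
  have hE' : ∀ X, X * E * E = 0 := fun X => by rw [mul_assoc, hE, mul_zero]
  apply ext_blocks <;>
    simp [h0, h1, mul_sub, sub_mul, ← mul_assoc, hE, hE']

end Queer

/-! ### Weights and local nilpotency in modules generated by highest weight vectors -/

section Relations

variable {n : ℕ} {A : Type v} [CommRing A] [Algebra ℂ A]

theorem WeylRel.raiseSet_smul {M : Type u} [AddCommGroup M] [Module ℂ M]
    [Module (Env (Current n A)) M] {lam : Module.Dual ℂ (cartanEven n)} {w : M}
    (h : WeylRel A lam w) :
    ∀ y ∈ raiseSet n A, (Env.ι y : Env (Current n A)) • w = 0 := by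
  rintro _ ⟨s, i, j, a, hij, rfl⟩
  exact h.nPlus _ (unitE_mem_nPlus s hij) a

variable {M : Type u} [AddCommGroup M] [Module ℂ M] [Module (Env (Current n A)) M]
  [IsScalarTower ℂ (Env (Current n A)) M] {lam : Module.Dual ℂ (cartanEven n)}

theorem unitE_zero (i j : Fin n) : unitE 0 i j = evenE i j := if_pos rfl

/-- The matrix units left after discarding $\mathfrak n^+\otimes A$ have $j\le i$, so each of them
shifts weights by an element of $-Q^+$. -/
theorem span_subset_weightSum {X : Set M} (hX : ∀ x ∈ X, x ∈ weightSpace A M lam)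
    (hr : ∀ y ∈ raiseSet n A, ∀ x ∈ X, (Env.ι y : Env (Current n A)) • x = 0) {m : M}
    (hm : m ∈ Submodule.span (Env (Current n A)) X) :
    m ∈ weightSum A M {μ | lam - μ ∈ rootMonoid n} := by
  refine span_subset_of_stable lowerSet_homogeneous span_lowerSet_union_raiseSet hr
    (fun x hx => mem_weightSum ?_ (hX x hx)) ?_ hm
  · simp
  · rintro _ ⟨s, i, j, a, hij, rfl⟩ m hm
    refine ι_smul_mem_weightSum ?_ (isRootVector_unitE s i j) a hm
    intro μ hμ
    have : lam - (μ + (epsilon i - epsilon j)) = lam - μ + (epsilon j - epsilon i) := by abel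
    rw [Set.mem_ofPred_eq, this]
    exact add_mem hμ (root_mem_rootMonoid hij)

/-- In a module generated by vectors `X` of weight `λ` killed by `n⁺ ⊗ A`, the weight space of
weight `λ` is contained in every subspace of it that contains `X` and is stable under `h ⊗ A`. -/
theorem weightSpace_subset_of_stable {X : Set M}
    (hr : ∀ y ∈ raiseSet n A, ∀ x ∈ X, (Env.ι y : Env (Current n A)) • x = 0)
    {N : Submodule ℂ M} (hN : N ≤ weightSpace A M lam) (hXN : X ⊆ N)
    (hc : ∀ x ∈ cartan n, ∀ (a : A), ∀ m ∈ N, (Env.ι (x ⊗ₜ a) : Env (Current n A)) • m ∈ N)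
    {m : M} (hm : m ∈ Submodule.span (Env (Current n A)) X) (hlam : m ∈ weightSpace A M lam) :
    m ∈ N := by
  -- The weights strictly below $\lambda$. Excluding $\lambda$ makes the weight sum over `S`
  -- independent of the weight space that contains `N`.
  let S : Set (Module.Dual ℂ (cartanEven n)) := {μ | lam - μ ∈ rootMonoid n ∧ μ ≠ lam}
  have hroot : ∀ (β : Module.Dual ℂ (cartanEven n)), β ∈ rootMonoid n → ∀ i j : Fin n, j < i →
      lam - β + (epsilon i - epsilon j) ∈ S := by
    intro β hβ i j hij
    have h1 : lam - (lam - β + (epsilon i - epsilon j)) = β + (epsilon j - epsilon i) := by abel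
    refine ⟨?_, fun h => add_ne_zero_of_lt hβ hij ?_⟩
    · rw [h1]; exact add_mem hβ (root_mem_rootMonoid hij.le)
    · rw [← h1, h, sub_self]
  -- Diagonal units preserve `N` by hypothesis and preserve each weight in `S`. Strictly lower units
  -- send both summands into weights strictly below $\lambda$, by pointedness.
  have hstable : ∀ y ∈ lowerSet n A, ∀ m ∈ N ⊔ weightSum A M S,
      (Env.ι y : Env (Current n A)) • m ∈ N ⊔ weightSum A M S := by
    rintro _ ⟨s, i, j, a, hij, rfl⟩ m hm
    obtain ⟨u, hu, v, hv, rfl⟩ := Submodule.mem_sup.1 hm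
    rw [smul_add]
    rcases hij.eq_or_lt with rfl | hij
    · refine Submodule.add_mem_sup (hc _ (unitE_mem_cartan s j) a u hu)
        (ι_smul_mem_weightSum ?_ (isRootVector_unitE s j j) a hv)
      intro μ hμ
      rwa [sub_self, add_zero]
    · refine Submodule.mem_sup_right (add_mem ?_ ?_)
      · refine mem_weightSum ?_ (ι_smul_mem_weightSpace (isRootVector_unitE s i j) a (hN hu))
        simpa using hroot 0 (zero_mem _) i j hij
      · refine ι_smul_mem_weightSum ?_ (isRootVector_unitE s i j) a hv
        intro μ hμ
        simpa using hroot _ hμ.1 i j hij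
  obtain ⟨u, hu, v, hv, rfl⟩ := Submodule.mem_sup.1 (span_subset_of_stable lowerSet_homogeneous
    span_lowerSet_union_raiseSet hr (hXN.trans (SetLike.coe_subset_coe.2 le_sup_left)) hstable hm)
  -- The component `v` has weight $\lambda$, being a difference of two such vectors, and also lies
  -- in the sum over `S`; so it is zero.
  have hv' : v ∈ weightSpace A M lam := by simpa using sub_mem hlam (hN hu)
  rw [eq_zero_of_mem_weightSum (fun h => h.2 rfl) hv' hv, add_zero]
  exact hu

/-- If a module is generated by vectors on which `f_i` acts nilpotently, then
`f_i^{λ(h_i)+1} w = 0` for every vector `w` of weight `λ` killed by `e_i`. -/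
theorem evenE_pow_smul_eq_zero {X : Set M} {i j : Fin n} (hij : i ≠ j)
    (hX : ∀ x ∈ X, ∃ k : ℕ, (Env.ι (evenE j i ⊗ₜ 1) : Env (Current n A)) ^ k • x = 0) {m : ℕ}
    (hm : lam (kEven i) - lam (kEven j) = m) {w : M}
    (hwX : w ∈ Submodule.span (Env (Current n A)) X) (hw : w ∈ weightSpace A M lam)
    (he : (Env.ι (evenE i j ⊗ₜ 1) : Env (Current n A)) • w = 0) :
    (Env.ι (evenE j i ⊗ₜ 1) : Env (Current n A)) ^ (m + 1) • w = 0 := by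
  have hgr : ∀ i j : Fin n, evenE i j ⊗ₜ (1 : A) ∈ (currentAlgebra (Queer n) A).gr 0 :=
    fun i j => tmul_mem_gr (unitE_zero i j ▸ unitE_mem 0 i j) 1
  -- The vectors on which $f_i$ acts nilpotently form a subspace. It is stable under $\mathfrak
  -- q\otimes A$ because $(\operatorname{ad} f_i)^3=0$, so it contains the module generated by `X`.
  let N : Submodule ℂ M :=
    { carrier := {x | ∃ k : ℕ, (Env.ι (evenE j i ⊗ₜ 1) : Env (Current n A)) ^ k • x = 0}
      zero_mem' := ⟨0, smul_zero _⟩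
      add_mem' := by
        rintro a b ⟨k, hk⟩ ⟨l, hl⟩
        refine ⟨k + l, ?_⟩
        rw [smul_add, pow_add, mul_smul _ _ b, hl, pow_mul_comm, mul_smul _ _ a, hk]
        simp
      smul_mem' := by
        rintro c a ⟨k, hk⟩
        exact ⟨k, by rw [smul_comm, hk, smul_zero]⟩ }
  have hN : w ∈ N := by
    refine span_subset_of_ι_smul_mem (N := N) hX ?_ hwX
    intro y x hx
    induction y using TensorProduct.induction_on with
    | zero => simp
    | add a b ha hb => rw [map_add, add_smul]; exact add_mem ha hb
    | tmul a b =>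
      obtain ⟨k, hk⟩ := hx
      refine exists_pow_smul_eq_zero (hgr j i) 3 (a ⊗ₜ b) ?_ k x hk
      simp only [pow_succ, pow_zero, one_mul, Module.End.mul_apply, currentAlgebra_bracket_tmul]
      rw [bracket_evenE_pow_three hij.symm, TensorProduct.zero_tmul]
  obtain ⟨k, hk⟩ := hN
  have hh := hw (kEven i - kEven j)
  rw [incl_apply, (map_sub lam (kEven i) (kEven j)).trans hm] at hh
  -- Now `w` is a primitive vector of $h_i$-weight `m` killed by some power of $f_i$. The remaining
  -- goals are the relations $[e_i,f_i]=h_i$ and $[h_i,f_i]=-2f_i$.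
  refine pow_smul_eq_zero_of_sl2 ?_ ?_ he hh hk
  · rw [Env.even_mul (hgr i j), currentAlgebra_bracket_tmul, one_mul, bracket_evenE_evenE]
  · rw [Env.even_mul (tmul_mem_gr (kEven i - kEven j).2.2 1), currentAlgebra_bracket_tmul, one_mul,
      ← unitE_zero, isRootVector_unitE 0 j i, ← TensorProduct.smul_tmul', map_smul]
    have : (epsilon j - epsilon i : Module.Dual ℂ (cartanEven n)) (kEven i - kEven j) = -2 := by
      have h : ∀ l : Fin n, epsilon l (kEven i - kEven j) =
          epsilon l (kEven i) - epsilon l (kEven j) := fun l => map_sub (epsilon l) _ _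
      rw [LinearMap.sub_apply, h, h]
      simp only [epsilon_kEven, if_true, if_neg hij, if_neg hij.symm]
      norm_num
    rw [this, neg_smul]
    abel

theorem WeylRel.mem_weightSpace {w : M} (h : WeylRel A lam w) : w ∈ weightSpace A M lam :=
  h.weight

theorem ι_tmul_smul_eq_zero_of_mem_nPlus {w : M}
    (h : ∀ y ∈ raiseSet n A, (Env.ι y : Env (Current n A)) • w = 0) {x : Queer n}
    (hx : x ∈ nPlus n) (a : A) : (Env.ι (x ⊗ₜ a) : Env (Current n A)) • w = 0 := by
  have hx' := tmul_mem_span_raiseSet hx a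
  generalize x ⊗ₜ[ℂ] a = z at hx'
  induction hx' using Submodule.span_induction with
  | mem y hy => exact h y hy
  | zero => simp
  | add x y _ _ hx hy => rw [map_add, add_smul, hx, hy, add_zero]
  | smul c x _ hx => rw [map_smul, smul_assoc, hx, smul_zero]

/-- The difference is minus a positive root, and adding that root to it gives zero, which
pointedness forbids for an element of $Q^+$. -/
theorem sub_add_root_notMem_rootMonoid {i j : Fin n} (hij : i < j) :
    lam - (lam + (epsilon i - epsilon j)) ∉ rootMonoid n := by
  intro h
  refine add_ne_zero_of_lt h hij ?_
  abel

end Relations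

/-! ### Modules generated by vectors that satisfy the Weyl relations -/

section Presentation

variable {n : ℕ} {A : Type v} [CommRing A] [Algebra ℂ A]
  {lam : Module.Dual ℂ (cartanEven n)}

section Generators

variable {W : Type u} [AddCommGroup W] [Module ℂ W] [Module (Env (Current n A)) W]
  [IsScalarTower ℂ (Env (Current n A)) W] {X : Set W}

/-- All weights lie in $\lambda-Q^+$, so positive root vectors kill the weight space of $\lambda$.
In particular $e_i$ does, and the exponent for $f_i$ follows from its nilpotency on the generators.
-/
theorem weylRel_of_mem_weightSpace (hX : Submodule.span (Env (Current n A)) X = ⊤)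
    (hrel : ∀ x ∈ X, WeylRel A lam x) {w : W} (hw : w ∈ weightSpace A W lam) :
    WeylRel A lam w := by
  have hspan : ∀ w, w ∈ Submodule.span (Env (Current n A)) X := by
    intro w; rw [hX]; trivial
  have hr : ∀ y ∈ raiseSet n A, (Env.ι y : Env (Current n A)) • w = 0 := by
    rintro _ ⟨s, i, j, a, hij, rfl⟩
    exact eq_zero_of_mem_weightSum (S := {μ | lam - μ ∈ rootMonoid n})
      (sub_add_root_notMem_rootMonoid hij)
      (ι_smul_mem_weightSpace (isRootVector_unitE s i j) a hw)
      (span_subset_weightSum (fun x hx => (hrel x hx).mem_weightSpace)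
        (fun y hy x hx => (hrel x hx).raiseSet_smul y hy) (hspan _))
  have hn : ∀ x ∈ nPlus n, ∀ a : A, (Env.ι (x ⊗ₜ a) : Env (Current n A)) • w = 0 :=
    fun x hx a => ι_tmul_smul_eq_zero_of_mem_nPlus hr hx a
  refine ⟨hn, hw, fun i j hij m hm => ?_⟩
  have hlt : i < j := Fin.lt_def.2 (by omega)
  exact evenE_pow_smul_eq_zero hlt.ne
    (fun x hx => ⟨m + 1, (hrel x hx).lower i j hij m hm⟩) hm (hspan w) hw
    (hn _ (unitE_zero i j ▸ unitE_mem_nPlus 0 hlt) 1)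

theorem span_weightSpace (hX : Submodule.span (Env (Current n A)) X = ⊤)
    (hrel : ∀ x ∈ X, WeylRel A lam x) :
    Submodule.span (Env (Current n A)) (weightSpace A W lam : Set W) = ⊤ := by
  rw [eq_top_iff, ← hX]
  exact Submodule.span_mono fun x hx => (hrel x hx).mem_weightSpace

/-- A linear map defined on the weight space of weight `λ` and compatible with `h ⊗ A` is
determined by its values on generators of weight `λ`. -/
theorem eqOn_weightSpace (hX : Submodule.span (Env (Current n A)) X = ⊤)
    (hrel : ∀ x ∈ X, WeylRel A lam x) {M : Type w} [AddCommGroup M] [Module ℂ M]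
    [Module (Env (Current n A)) M] [IsScalarTower ℂ (Env (Current n A)) M]
    (φ : weightSpace A W lam →ₗ[ℂ] M)
    (hact : ∀ y ∈ cartanCurrent n A, ∀ m m' : weightSpace A W lam,
      (Env.ι y : Env (Current n A)) • (m : W) = m' →
      (Env.ι y : Env (Current n A)) • φ m = φ m')
    (Φ : W →ₗ[Env (Current n A)] M)
    (hΦ : ∀ m : weightSpace A W lam, (m : W) ∈ X → Φ m = φ m) (m : weightSpace A W lam) :
    Φ m = φ m := by
  -- The locus where `Φ` and `φ` agree, viewed as a subspace of `W`. It contains the generators and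
  -- is stable under $\mathfrak h\otimes A$, hence is the whole weight space.
  let N : Submodule ℂ W :=
    (LinearMap.ker ((Φ.restrictScalars ℂ ∘ₗ (weightSpace A W lam).subtype) - φ)).map
      (weightSpace A W lam).subtype
  have hN : ∀ w : weightSpace A W lam, (w : W) ∈ N → Φ w = φ w := by
    rintro w ⟨w', hw', h⟩
    obtain rfl : w' = w := Subtype.ext h
    exact sub_eq_zero.1 hw'
  have hN' : ∀ w : weightSpace A W lam, Φ w = φ w → (w : W) ∈ N :=
    fun w h => ⟨w, sub_eq_zero.2 h, rfl⟩
  refine hN m (weightSpace_subset_of_stable (fun y hy x hx => (hrel x hx).raiseSet_smul y hy)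
    (Submodule.map_subtype_le _ _)
    (fun x hx => hN' ⟨x, (hrel x hx).mem_weightSpace⟩ (hΦ _ hx)) ?_ (by rw [hX]; trivial) m.2)
  intro x hx a m hm
  have hmw := Submodule.map_subtype_le _ _ hm
  have hxa : x ⊗ₜ a ∈ cartanCurrent n A := ⟨(⟨x, hx⟩ : cartan n) ⊗ₜ a, rfl⟩
  refine hN' ⟨_, ι_smul_mem_weightSpace_of_cartanCurrent hxa hmw⟩ ?_
  rw [← hact _ hxa ⟨m, hmw⟩ _ rfl, ← hN ⟨m, hmw⟩ hm]
  exact map_smul Φ _ _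

end Generators

/-- A presentation is determined by the relations that hold and by the existence of linear maps. -/
theorem isWeylPresentation_of_exists {V : Type u} [AddCommGroup V] [Module ℂ V]
    [SuperSpace V] {act : Current n A → V → V → Prop} {W : Type (max u v)} [AddCommGroup W]
    [Module ℂ W] [Module (Env (Current n A)) W] [IsScalarTower ℂ (Env (Current n A)) W]
    [SuperSpace W] [IsSuperModule (Current n A) W] {j : V →ₗ[ℂ] W} (heven : IsEvenMap j)
    (hspan : Submodule.span (Env (Current n A)) (Set.range j) = ⊤)
    (hact : ∀ y v v', act y v v' → (Env.ι y : Env (Current n A)) • j v = j v')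
    (hrel : ∀ v, WeylRel A lam (j v))
    (hex : ∀ (M : Type w) [AddCommGroup M] [Module ℂ M] [Module (Env (Current n A)) M]
      [IsScalarTower ℂ (Env (Current n A)) M] (φ : V →ₗ[ℂ] M),
      (∀ y v v', act y v v' → (Env.ι y : Env (Current n A)) • φ v = φ v') →
      (∀ v, WeylRel A lam (φ v)) →
      ∃ Φ : W →ₗ[Env (Current n A)] M, ∀ v, Φ (j v) = φ v) :
    IsWeylPresentation.{u, v, w} A lam act j := by
  refine ⟨heven, hspan, hact, hrel, ?_⟩
  intro M _ _ _ _ _ _ φ hφ hact hrel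
  obtain ⟨Φ, hΦ⟩ := hex M φ hact hrel
  -- Evenness of the lift is automatic: `j` and `φ` are even, so `Φ` commutes with the parity
  -- involutions on the generators.
  refine ⟨Φ, ⟨isEvenMap_of_span Φ hspan ?_, hΦ⟩, fun Φ' h => ?_⟩
  · rintro _ ⟨v, rfl⟩
    rw [hΦ, parity_map hφ, parity_map heven, hΦ]
  · refine LinearMap.ext_on_range hspan fun v => ?_
    rw [h.2, hΦ]

/-- Enlarging the generating space imposes no new condition on the module: $(*)$ spreads to the
whole weight space, and the action of $\mathfrak h\otimes A$ determines the rest. The hypothesis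
`hcartan` ensures that a map compatible with $\mathfrak h\otimes A$ restricts along `j` to one
compatible with `act`. -/
theorem IsWeylPresentation.weightSpace_subtype {V : Type u} [AddCommGroup V] [Module ℂ V]
    [SuperSpace V] {act : Current n A → V → V → Prop} {W : Type (max u v)} [AddCommGroup W]
    [Module ℂ W] [Module (Env (Current n A)) W] [IsScalarTower ℂ (Env (Current n A)) W]
    [SuperSpace W] [IsSuperModule (Current n A) W] {j : V →ₗ[ℂ] W}
    (h : IsWeylPresentation.{u, v, w} A lam act j)
    (hcartan : ∀ y v v', act y v v' → y ∈ cartanCurrent n A) :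
    IsWeylPresentation.{max u v, v, w} A lam
      (fun y (m m' : weightSpace A W lam) => y ∈ cartanCurrent n A ∧
        (Env.ι y : Env (Current n A)) • (m : W) = m')
      (weightSpace A W lam).subtype := by
  have hrel : ∀ x ∈ Set.range j, WeylRel A lam x := by
    rintro _ ⟨v, rfl⟩; exact h.rel v
  have hspan := span_weightSpace h.span_eq_top hrel
  refine ⟨fun _ _ hx => hx, ?_, fun _ _ _ h => h.2,
    fun m => weylRel_of_mem_weightSpace h.span_eq_top hrel m.2, ?_⟩
  · rw [← hspan]
    congr 1
    exact Subtype.range_coe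
  · intro M _ _ _ _ _ _ φ heven hact hφ
    have hmem : ∀ v, j v ∈ weightSpace A W lam := fun v => (h.rel v).mem_weightSpace
    obtain ⟨Φ, ⟨hΦ, hΦφ⟩, -⟩ := h.existsUnique M (φ ∘ₗ LinearMap.codRestrict _ j hmem)
      (fun i v hv => heven i _ (h.even i v hv))
      (fun y v v' hv => hact _ _ _ ⟨hcartan y v v' hv, h.smul_eq y v v' hv⟩) (fun v => hφ _)
    have hext : ∀ m : weightSpace A W lam, Φ m = φ m := by
      refine eqOn_weightSpace h.span_eq_top hrel φ (fun y hy m m' hm => hact y m m' ⟨hy, hm⟩) Φ ?_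
      rintro ⟨_, hm⟩ ⟨v, rfl⟩
      exact hΦφ v
    refine ⟨Φ, ⟨hΦ, hext⟩, fun Φ' h' => LinearMap.ext_on hspan fun w hw => ?_⟩
    exact (h'.2 ⟨w, hw⟩).trans (hext ⟨w, hw⟩).symm

end Presentation

/-! ### The truncation -/

section Truncation

variable {n : ℕ} {A : Type v} [CommRing A] [Algebra ℂ A]
  {lam : Module.Dual ℂ (cartanEven n)}
  {P : Type u} [AddCommGroup P] [Module ℂ P] [Module (Env (Current n A)) P]
  [IsScalarTower ℂ (Env (Current n A)) P]

/-- Only the relation for $\mathfrak n^+\otimes A$ uses the truncation: a positive root vector moves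
`p` to a weight outside $\lambda-Q^+$. The other two are inherited from `P`. -/
theorem weylRel_mkQ_truncSub {p : P} (hp : p ∈ weightSpace A P lam)
    (hlower : ∀ i j : Fin n, (j : ℕ) = i + 1 → ∀ m : ℕ, lam (kEven i) - lam (kEven j) = m →
      (Env.ι (evenE j i ⊗ₜ 1) : Env (Current n A)) ^ (m + 1) • p = 0) :
    WeylRel A lam ((truncSub A P lam).mkQ p) where
  nPlus := by
    intro x hx a
    refine ι_tmul_smul_eq_zero_of_mem_nPlus ?_ hx a
    rintro _ ⟨s, i, j, a, hij, rfl⟩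
    exact (Submodule.Quotient.mk_eq_zero _).2 (Submodule.subset_span
      ⟨_, sub_add_root_notMem_rootMonoid hij,
        ι_smul_mem_weightSpace (isRootVector_unitE s i j) a hp⟩)
  weight h := congrArg (truncSub A P lam).mkQ (hp h)
  lower i j hij m hm := congrArg (truncSub A P lam).mkQ (hlower i j hij m hm)

theorem span_range_mkQ_truncSub {V : Type w} {g : V → P}
    (hg : Submodule.span (Env (Current n A)) (Set.range g) = ⊤) :
    Submodule.span (Env (Current n A)) (Set.range fun v => (truncSub A P lam).mkQ (g v)) = ⊤ := by
  have h := congrArg (Submodule.map (truncSub A P lam).mkQ) hg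
  rw [Submodule.map_span, Submodule.map_top, Submodule.range_mkQ, ← Set.range_comp] at h
  exact h

/-- The image of `Ψ` is generated by vectors satisfying $(*)$, so its weights lie in $\lambda-Q^+$.
A vector of any other weight must therefore map to zero. -/
theorem exists_truncation_lift {M : Type w} [AddCommGroup M] [Module ℂ M]
    [Module (Env (Current n A)) M] [IsScalarTower ℂ (Env (Current n A)) M]
    (Ψ : P →ₗ[Env (Current n A)] M) {V : Type*} {g : V → P}
    (hg : Submodule.span (Env (Current n A)) (Set.range g) = ⊤)
    (hrel : ∀ v, WeylRel A lam (Ψ (g v))) :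
    ∃ Φ : Truncation A P lam →ₗ[Env (Current n A)] M,
      ∀ p, Φ ((truncSub A P lam).mkQ p) = Ψ p := by
  have hrange : ∀ p, Ψ p ∈ weightSum A M {μ | lam - μ ∈ rootMonoid n} := by
    intro p
    refine span_subset_weightSum (X := Set.range (Ψ ∘ g)) ?_ ?_ ?_
    · rintro _ ⟨v, rfl⟩; exact (hrel v).mem_weightSpace
    · rintro y hy _ ⟨v, rfl⟩; exact (hrel v).raiseSet_smul y hy
    · rw [Set.range_comp, ← Submodule.map_span, hg]
      exact Submodule.mem_map_of_mem trivial
  have hker : truncSub A P lam ≤ LinearMap.ker Ψ := by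
    refine Submodule.span_le.2 ?_
    rintro p ⟨μ, hμ, hp⟩
    refine eq_zero_of_mem_weightSum (μ := μ) hμ (fun h => ?_) (hrange p)
    rw [← map_smul, hp h]
    exact map_smul (Ψ.restrictScalars ℂ) _ _
  exact ⟨(truncSub A P lam).liftQ Ψ hker, fun p => rfl⟩

end Truncation

/-! ### Generators and relations of `L̄(λ)`, `P_A(L̄(λ))` and `W_A(λ)` -/

section Weyl

variable {n : ℕ} {A : Type v} [CommRing A] [Algebra ℂ A]
  {L : Type u} [AddCommGroup L] [Module ℂ L] [Module (Env (Queer n)) L]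
  [IsScalarTower ℂ (Env (Queer n)) L] {lam : Module.Dual ℂ (cartanEven n)}

theorem mkQ_lbarSub_tmul (a : Env (Queer n)) (k : queerWeightSpace L lam) :
    (lbarSub L lam).mkQ (a ⊗ₜ k) = a • lbarGen L lam k := by
  change _ = a • (lbarSub L lam).mkQ (1 ⊗ₜ k)
  rw [← map_smul, TensorProduct.smul_tmul', smul_eq_mul, mul_one]

theorem mkQ_lbarSub_of_rel {t : FreeMod (Queer n) (queerWeightSpace L lam)}
    (ht : LbarRel L lam t) : (lbarSub L lam).mkQ t = 0 :=
  (Submodule.Quotient.mk_eq_zero _).2 (Submodule.subset_span ht)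

theorem ι_smul_lbarGen_cartan {x : Queer n} (hx : x ∈ cartan n) {k k' : queerWeightSpace L lam}
    (hk : (Env.ι x : Env (Queer n)) • (k : L) = k') :
    (Env.ι x : Env (Queer n)) • lbarGen L lam k = lbarGen L lam k' := by
  have h := mkQ_lbarSub_of_rel (LbarRel.cartan x hx k k' hk)
  rwa [map_sub, mkQ_lbarSub_tmul, mkQ_lbarSub_tmul, one_smul, sub_eq_zero] at h

/-- This relation is already contained in the $\mathfrak h$-module structure of
$L(\lambda)_\lambda$, on which $h$ acts by $\lambda(h)$. -/
theorem ι_smul_lbarGen_weight (h : cartanEven n) (k : queerWeightSpace L lam) :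
    (Env.ι (h : Queer n) : Env (Queer n)) • lbarGen L lam k = lam h • lbarGen L lam k := by
  rw [ι_smul_lbarGen_cartan h.2.1 (k' := lam h • k) (k.2 h), map_smul]

theorem pow_smul_lbarGen {i j : Fin n} (hij : (j : ℕ) = i + 1) {m : ℕ}
    (hm : lam (kEven i) - lam (kEven j) = m) (k : queerWeightSpace L lam) :
    (Env.ι (evenE j i) : Env (Queer n)) ^ (m + 1) • lbarGen L lam k = 0 := by
  rw [← mkQ_lbarSub_tmul]
  exact mkQ_lbarSub_of_rel (LbarRel.lower i j hij m hm k)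

section Induced

variable {V : Type u} [AddCommGroup V] [Module ℂ V] [Module (Env (Queer n)) V]

theorem mkQ_inducedSub_tmul (u : Env (Current n A)) (v : V) :
    (inducedSub n A V).mkQ (u ⊗ₜ v) = u • inducedGen n A V v := by
  change _ = u • (inducedSub n A V).mkQ (1 ⊗ₜ v)
  rw [← map_smul, TensorProduct.smul_tmul', smul_eq_mul, mul_one]

theorem inducedGen_smul (s : Env (Queer n)) (v : V) :
    inducedGen n A V (s • v) = envIncl n A s • inducedGen n A V v := by
  have h : (inducedSub n A V).mkQ ((1 * envIncl n A s) ⊗ₜ v - 1 ⊗ₜ (s • v)) = 0 :=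
    (Submodule.Quotient.mk_eq_zero _).2 (Submodule.subset_span ⟨1, s, v, rfl⟩)
  rw [map_sub, mkQ_inducedSub_tmul, mkQ_inducedSub_tmul, one_smul, one_mul, sub_eq_zero] at h
  exact h.symm

end Induced

variable (A L lam) in
theorem span_range_inducedGen_lbarGen : Submodule.span (Env (Current n A))
    (Set.range fun k => inducedGen n A (Lbar L lam) (lbarGen L lam k)) = ⊤ := by
  set S := Submodule.span (Env (Current n A))
    (Set.range fun k => inducedGen n A (Lbar L lam) (lbarGen L lam k)) with hS
  have h1 : ∀ v, inducedGen n A (Lbar L lam) v ∈ S := by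
    intro v
    obtain ⟨t, rfl⟩ := (lbarSub L lam).mkQ_surjective v
    induction t using TensorProduct.induction_on with
    | zero => rw [map_zero, map_zero]; exact zero_mem _
    | add a b ha hb => rw [map_add, map_add]; exact add_mem ha hb
    | tmul a k =>
      rw [mkQ_lbarSub_tmul, inducedGen_smul]
      exact S.smul_mem _ (Submodule.subset_span ⟨k, rfl⟩)
  rw [eq_top_iff]
  intro p _
  obtain ⟨t, rfl⟩ := (inducedSub n A (Lbar L lam)).mkQ_surjective p
  induction t using TensorProduct.induction_on with
  | zero => rw [map_zero]; exact zero_mem _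
  | add a b ha hb => rw [map_add]; exact add_mem (ha trivial) (hb trivial)
  | tmul u v => rw [mkQ_inducedSub_tmul]; exact S.smul_mem _ (h1 v)

theorem inducedGen_lbarGen_mem_weightSpace (k : queerWeightSpace L lam) :
    inducedGen n A (Lbar L lam) (lbarGen L lam k) ∈
      weightSpace A (Induced n A (Lbar L lam)) lam := by
  intro h
  rw [← envIncl_ι, ← inducedGen_smul, ι_smul_lbarGen_weight, map_smul]

theorem pow_smul_inducedGen_lbarGen {i j : Fin n} (hij : (j : ℕ) = i + 1) {m : ℕ}
    (hm : lam (kEven i) - lam (kEven j) = m) (k : queerWeightSpace L lam) :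
    (Env.ι (evenE j i ⊗ₜ 1) : Env (Current n A)) ^ (m + 1) •
      inducedGen n A (Lbar L lam) (lbarGen L lam k) = 0 := by
  rw [← incl_apply, ← envIncl_ι, ← map_pow, ← inducedGen_smul, pow_smul_lbarGen hij hm, map_zero]

theorem ι_smul_inducedGen_lbarGen {x : Queer n} (hx : x ∈ cartan n)
    {k k' : queerWeightSpace L lam} (hk : (Env.ι x : Env (Queer n)) • (k : L) = k') :
    (Env.ι (x ⊗ₜ 1) : Env (Current n A)) • inducedGen n A (Lbar L lam) (lbarGen L lam k) =
      inducedGen n A (Lbar L lam) (lbarGen L lam k') := by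
  rw [← incl_apply, ← envIncl_ι, ← inducedGen_smul, ι_smul_lbarGen_cartan hx hk]

/-! ### Universal properties of $\bar L(\lambda)$ and of the induced module -/

section Lift

variable {M : Type w} [AddCommGroup M] [Module ℂ M] [Module (Env (Current n A)) M]
  [IsScalarTower ℂ (Env (Current n A)) M]

/-- The result is stated as a linear map intertwining the actions along `envIncl`, so that the
restricted $U(\mathfrak q)$-structure on `M` stays local to the proof. -/
theorem exists_lbar_lift (φ : queerWeightSpace L lam →ₗ[ℂ] M)
    (hact : ∀ x ∈ cartan n, ∀ k k' : queerWeightSpace L lam,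
      (Env.ι x : Env (Queer n)) • (k : L) = k' →
      (Env.ι (x ⊗ₜ 1) : Env (Current n A)) • φ k = φ k')
    (hrel : ∀ k, WeylRel A lam (φ k)) :
    ∃ ψ : Lbar L lam →ₗ[ℂ] M, (∀ s v, ψ (s • v) = envIncl n A s • ψ v) ∧
      ∀ k, ψ (lbarGen L lam k) = φ k := by
  let _ : Module (Env (Queer n)) M := Module.compHom M (envIncl n A).toRingHom
  have hsmul : ∀ (s : Env (Queer n)) (m : M), s • m = envIncl n A s • m := fun _ _ => rfl
  have : IsScalarTower ℂ (Env (Queer n)) M :=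
    ⟨fun c s m => by rw [hsmul, hsmul, map_smul, smul_assoc]⟩
  obtain ⟨F, hF⟩ := exists_freeMod_lift (g := Queer n) φ
  have hker : lbarSub L lam ≤ LinearMap.ker F := by
    refine Submodule.span_le.2 ?_
    intro t ht
    change F t = 0
    obtain ⟨x, hx, k, k', hk⟩ | ⟨x, hx, k⟩ | ⟨h, k⟩ | ⟨i, j, hij, m, hm, k⟩ := ht
    · rw [map_sub, hF, hF, one_smul, hsmul, envIncl_ι, incl_apply, hact x hx k k' hk, sub_self]
    · rw [hF, hsmul, envIncl_ι, incl_apply, (hrel k).nPlus x hx]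
    · have h1 := map_smul (F.restrictScalars ℂ) (lam h) (1 ⊗ₜ k)
      rw [LinearMap.restrictScalars_apply, LinearMap.restrictScalars_apply] at h1
      rw [map_sub, h1, hF, hF, hsmul, envIncl_ι, incl_apply, (hrel k).weight, one_smul, sub_self]
    · rw [hF, hsmul, map_pow, envIncl_ι, incl_apply, (hrel k).lower i j hij m hm]
  refine ⟨((lbarSub L lam).liftQ F hker).restrictScalars ℂ, fun s v => ?_, fun k => ?_⟩
  · exact map_smul ((lbarSub L lam).liftQ F hker) s v
  · exact (hF 1 k).trans (one_smul _ _)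

/-- The existence half of Frobenius reciprocity. -/
theorem exists_induced_lift {V : Type u} [AddCommGroup V] [Module ℂ V] [Module (Env (Queer n)) V]
    (ψ : V →ₗ[ℂ] M) (hψ : ∀ s v, ψ (s • v) = envIncl n A s • ψ v) :
    ∃ Ψ : Induced n A V →ₗ[Env (Current n A)] M, ∀ v, Ψ (inducedGen n A V v) = ψ v := by
  obtain ⟨F, hF⟩ := exists_freeMod_lift (g := Current n A) ψ
  have hker : inducedSub n A V ≤ LinearMap.ker F := by
    refine Submodule.span_le.2 ?_
    rintro _ ⟨u, s, v, rfl⟩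
    change F _ = 0
    rw [map_sub, hF, hF, hψ, mul_smul, sub_self]
  exact ⟨(inducedSub n A V).liftQ F hker, fun v => (hF 1 v).trans (one_smul _ _)⟩

end Lift

variable [SuperSpace L] [IsSuperModule (Queer n) L]

variable (A L lam) in
-- The unit of an enveloping algebra is even, so $v\mapsto1\otimes v$ preserves parity, and the
-- quotient gradings are images of the gradings above.
theorem weylGen_even : IsEvenMap (weylGen A L lam) := by
  intro i k hk
  have h1 : (1 ⊗ₜ k : FreeMod (Queer n) (queerWeightSpace L lam)) ∈
      (gr i : Submodule ℂ (FreeMod (Queer n) (queerWeightSpace L lam))) := by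
    rw [mem_gr_iff, parity_tmul, map_one, parity_of_mem hk, TensorProduct.tmul_smul]
  have h2 : lbarGen L lam k ∈ (gr i : Submodule ℂ (Lbar L lam)) := ⟨_, h1, rfl⟩
  have h3 : (1 ⊗ₜ lbarGen L lam k : FreeMod (Current n A) (Lbar L lam)) ∈
      (gr i : Submodule ℂ (FreeMod (Current n A) (Lbar L lam))) := by
    rw [mem_gr_iff, parity_tmul, map_one, parity_of_mem h2, TensorProduct.tmul_smul]
  have h4 : inducedGen n A _ (lbarGen L lam k) ∈
      (gr i : Submodule ℂ (Induced n A (Lbar L lam))) := ⟨_, h3, rfl⟩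
  exact ⟨_, h4, rfl⟩

theorem weylGen_presentation : IsWeylPresentation.{u, v, w} A lam
    (fun y (k k' : queerWeightSpace L lam) => ∃ x ∈ cartan n, y = x ⊗ₜ[ℂ] (1 : A) ∧
      (Env.ι x : Env (Queer n)) • (k : L) = k')
    (weylGen A L lam) := by
  refine isWeylPresentation_of_exists (weylGen_even A L lam)
    (span_range_mkQ_truncSub (span_range_inducedGen_lbarGen A L lam)) ?_ (fun k => ?_) ?_
  · rintro _ k k' ⟨x, hx, rfl, hk⟩
    exact congrArg (truncSub A (Induced n A (Lbar L lam)) lam).mkQ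
      (ι_smul_inducedGen_lbarGen hx hk)
  · exact weylRel_mkQ_truncSub (inducedGen_lbarGen_mem_weightSpace k)
      fun i j hij m hm => pow_smul_inducedGen_lbarGen hij hm k
  · intro M _ _ _ _ φ hact hrel
    obtain ⟨ψ, hψ, hψφ⟩ := exists_lbar_lift φ
      (fun x hx k k' hk => hact _ k k' ⟨x, hx, rfl, hk⟩) hrel
    obtain ⟨Ψ, hΨ⟩ := exists_induced_lift ψ hψ
    have hΨφ : ∀ k, Ψ (inducedGen n A (Lbar L lam) (lbarGen L lam k)) = φ k :=
      fun k => (hΨ _).trans (hψφ k)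
    obtain ⟨Φ, hΦ⟩ := exists_truncation_lift (lam := lam) Ψ
      (span_range_inducedGen_lbarGen A L lam) fun k => (hΨφ k).symm ▸ hrel k
    exact ⟨Φ, fun k => (hΦ _).trans (hΨφ k)⟩

end Weyl

end QueerWeyl

/-! ### The proposition -/

theorem proposition3p5 {n : ℕ} (hn : 2 ≤ n) (A : Type v) [CommRing A] [Algebra ℂ A]
    (lam : Module.Dual ℂ (cartanEven n)) (hlam : lam ∈ dominantWeights n)
    (L : Type u) [AddCommGroup L] [Module ℂ L] [Module (Env (Queer n)) L]
    [IsScalarTower ℂ (Env (Queer n)) L] [SuperSpace L] [IsSuperModule (Queer n) L]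
    (hL : IsIrreducibleHighestWeight L lam) :
    Submodule.span (Env (Current n A))
        (weightSpace A (GlobalWeyl A L lam) lam : Set (GlobalWeyl A L lam)) = ⊤ ∧
      (∀ w ∈ weightSpace A (GlobalWeyl A L lam) lam, WeylRel A lam w) ∧
      (∀ k : queerWeightSpace L lam,
        weylGen A L lam k ∈ weightSpace A (GlobalWeyl A L lam) lam) ∧
      IsWeylPresentation.{u, v, w} A lam
        (fun y (k k' : queerWeightSpace L lam) => ∃ x ∈ cartan n, y = x ⊗ₜ[ℂ] (1 : A) ∧
          (Env.ι x : Env (Queer n)) • (k : L) = k')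
        (weylGen A L lam) ∧
      IsWeylPresentation.{max u v, v, w} A lam
        (fun y (m m' : weightSpace A (GlobalWeyl A L lam) lam) =>
          y ∈ cartanCurrent n A ∧
            (Env.ι y : Env (Current n A)) • (m : GlobalWeyl A L lam) = m')
        (weightSpace A (GlobalWeyl A L lam) lam).subtype := by
  have h : IsWeylPresentation.{u, v, w} A lam _ (weylGen A L lam) := weylGen_presentation
  have hrel : ∀ w ∈ Set.range (weylGen A L lam), WeylRel A lam w := by
    rintro _ ⟨k, rfl⟩; exact h.rel k
  refine ⟨span_weightSpace h.span_eq_top hrel,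
    fun w hw => weylRel_of_mem_weightSpace h.span_eq_top hrel hw,
    fun k => (h.rel k).mem_weightSpace, h, h.weightSpace_subtype ?_⟩
  -- The relations among the $w_k$ involve only $\mathfrak h\otimes1\subseteq\mathfrak h\otimes A$,
  -- as the passage to the whole weight space requires.
  rintro _ k k' ⟨x, hx, rfl, -⟩
  exact ⟨(⟨x, hx⟩ : cartan n) ⊗ₜ 1, rfl⟩
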